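/- For integers $j,n\ge 1$ let $\sigma_j(n)=\sum_{d\mid n}d^j$, and let $\sigma_j(x)=0$ if $x$ is not a positive integer. Let $\eta(z)=e^{2\pi i z/24}\prod_{m\ge 1}(1-e^{2\pi i m z})$ be the Dedekind eta function and let \[ \Delta_{8,2}(z)=[\eta(z)\eta(2z)]^8=\sum_{n=1}^{\infty}\tau_{8,2}(n)e^{2\pi i n z}\qquad(\operatorname{Im} z>0). \] Then $\Delta_{8,2}$ is a cusp form of weight $8$ on $\Gamma_0(2)$, it spans the space of cusp forms of weight $8$ on $\Gamma_0(2)$, and $\tau_{8,2}(1)=1$. Moreover, for every integer $n\ge 1$ (the index $k$ running through nonnegative integers), \[ \sum_{k=0}^n\sigma_1(k)\sigma_3(n-k)=\frac{7}{80}\sigma_5(n)-\frac{1}{8}n\sigma_3(n)+\frac{1}{24}\sigma_3(n)-\frac{1}{240}\sigma_1(n), \] \[ \sum_{k<n/2}\sigma_1(n-2k)\sigma_3(k)=\frac{1}{240}\sigma_5(n)+\frac{1}{12}\sigma_5\left(\frac n2\right)-\frac18 n\sigma_3\left(\frac n2\right)+\frac1{24}\sigma_3\left(\frac n2\right)-\frac1{240}\sigma_1(n),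 \] \[ \sum_{k<n/2}\sigma_1(k)\sigma_3(n-2k)=\frac1{48}\sigma_5(n)+\frac1{15}\sigma_5\left(\frac n2\right)-\frac1{16}n\sigma_3(n)+\frac1{24}\sigma_3(n)-\frac1{240}\sigma_1\left(\frac n2\right), \] \[ \sum_{k=0}^n\sigma_1(k)\sigma_5(n-k)=\frac5{126}\sigma_7(n)-\frac1{12}n\sigma_5(n)+\frac1{24}\sigma_5(n)+\frac1{504}\sigma_1(n), \] \[ \sum_{k<n/2}\sigma_1(k)\sigma_5(n-2k)=\frac1{102}\sigma_7(n)+\frac{32}{1071}\sigma_7\left(\frac n2\right)-\frac1{24}n\sigma_5(n)+\frac1{24}\sigma_5(n)+\frac1{504}\sigma_1\left(\frac n2\right)-\frac1{102}\tau_{8,2}(n), \] \[ \sum_{k<n/2}\sigma_1(n-2k)\sigma_5(k)=\frac1{2142}\sigma_7(n)+\frac2{51}\sigma_7\left(\frac n2\right)-\frac1{12}n\sigma_5\left(\frac n2\right)+\frac1{24}\sigma_5\left(\frac n2\right)+\frac1{504}\sigma_1(n)-\frac1{408}\tau_{8,2}(n). \] -/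

import Mathlib

open scoped ArithmeticFunction.sigma MatrixGroups

/-- `σ_j(n/2)`, with the convention that `σ_j` vanishes at arguments that are not
positive integers (in particular when `n` is odd). -/
def sigmaHalf (j n : ℕ) : ℕ :=
  if 2 ∣ n then σ j (n / 2) else 0

/-- The function `Δ_{8,2}(z) = (η(z) η(2z))⁸` on the upper half plane, where `η` is the
Dedekind eta function. -/
noncomputable def Delta82 (z : UpperHalfPlane) : ℂ :=
  (ModularForm.eta (z : ℂ) * ModularForm.eta (2 * (z : ℂ))) ^ 8

/-- `τ_{8,2}(n)`, the coefficient of `e^{2πinz}` in the Fourier expansion at `∞` of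
`Δ_{8,2}`. -/
noncomputable def tau82 (n : ℕ) : ℂ :=
  (UpperHalfPlane.qExpansion 1 Delta82).coeff n

/-- The space `S_8(Γ₀(2))` of cusp forms of weight `8` on `Γ₀(2)`. -/
abbrev CuspForms82 : Type :=
  CuspForm ((CongruenceSubgroup.Gamma0 2).map (Matrix.SpecialLinearGroup.mapGL ℝ)) 8

/-!
A modular form of weight `k` on `Γ₀(2)` has `k/4` zeros, counted with weights on the modular
curve. Everything below rests on two consequences of this, which are proved without the valence
formula by dividing by an eta quotient whose zeros are known.

* The function `Δ₈,₂` has no zero on the upper half plane and a simple zero at each of the cusps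
  `∞` and `0`, as its product expansion and the transformation `η(-1/τ)⁸ = τ⁴ η(τ)⁸` show. The
  quotient of a cusp form of weight `8` by `Δ₈,₂` is therefore a modular form of weight `0`, so it
  is constant (`exists_eq_smul_Delta82`).
* The quotient `η(2τ)¹⁶/η(τ)⁸` has weight `4`; it has a simple zero at `∞` and no other zero. If a
  form of weight `k` vanishes at `∞` to an order `m > k/4`, its quotient by the `m`-th power of
  this function is a modular form of negative weight, hence zero (`WeaklyModular.eq_zero`). So a
  form is determined by its Fourier coefficients of index at most `k/4`
  (`IsLevelTwoForm.series_eq_zero`).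

The convolution sums are Fourier coefficients of products such as `E₂(τ) E₄(2τ)`, which are not
modular. Subtracted from a derivative they become modular: for `F` of weight `k`, the Serre
derivative `ϑF = DF - (k/12) E₂ F`, with `D = (2πi)⁻¹ d/dτ`, has weight `k + 2`. It accounts for the
terms with a factor `n` in the formulas. The products with `E₂(2τ)` are obtained from those with
`E₂(τ)` by means of the form `2 E₂(2τ) - E₂(τ)` of weight `2`. This leads to six modular forms of
weight `6` or `8`, which are identified with linear combinations of `E₆(τ)` and `E₆(2τ)`,
respectively of `E₈(τ)`, `E₈(2τ)` and `Δ₈,₂`, by comparing two, respectively three, Fourier coefficients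
(`serreSeries_E₄` and the lemmas after it). The third coefficient involves `τ₈,₂(2) = -8`, which
comes from the logarithmic derivative of `Δ₈,₂`.

Modularity on `Γ₀(2)` is tested on generators: `F` must be invariant under `T` and its transform `G`
under `S`, which carries the behaviour at the cusp `0`, must be invariant under `T²`
(`Gamma0_two_le`, `WeaklyModular.slash_eq`).
-/

namespace LevelTwo

section Group

open UpperHalfPlane hiding I
open ModularGroup CongruenceSubgroup ModularForm Matrix Filter
open scoped Manifold Topology OnePoint

/-! ### The group `Γ₀(2)` -/

lemma S_mul_T_sq_mul_S_inv_zpow (m : ℤ) :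
    (((S * T ^ 2 * S⁻¹) ^ m : SL(2, ℤ)) : Matrix (Fin 2) (Fin 2) ℤ) = !![1, 0; -2 * m, 1] := by
  have h : (S * T ^ 2 * S⁻¹) ^ m = S * T ^ (2 * m) * S⁻¹ := by
    rw [conj_zpow, _root_.zpow_mul]; norm_cast
  rw [h]
  simp only [Matrix.SpecialLinearGroup.coe_mul, coe_T_zpow, coe_S,
    Matrix.SpecialLinearGroup.coe_inv, Matrix.adjugate_fin_two]
  simp

lemma zpow_mul_T_zpow_mul_apply_one_zero (m n : ℤ) (γ : SL(2, ℤ)) :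
    ((S * T ^ 2 * S⁻¹) ^ m * (T ^ n * γ) : SL(2, ℤ)) 1 0 =
      γ 1 0 - 2 * m * (γ 0 0 + n * γ 1 0) := by
  rw [Matrix.SpecialLinearGroup.coe_mul, Matrix.SpecialLinearGroup.coe_mul,
    S_mul_T_sq_mul_S_inv_zpow, coe_T_zpow]
  simp [Matrix.mul_apply, Fin.sum_univ_two, Matrix.vecMul, dotProduct]
  ring

lemma mul_T_zpow_mul_S_inv_apply_one_zero (n : ℤ) (γ : SL(2, ℤ)) :
    (γ * T ^ n * S⁻¹ : SL(2, ℤ)) 1 0 = - (n * γ 1 0 + γ 1 1) := by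
  rw [Matrix.SpecialLinearGroup.coe_mul, Matrix.SpecialLinearGroup.coe_mul,
    Matrix.SpecialLinearGroup.coe_inv, coe_T_zpow, coe_S, Matrix.adjugate_fin_two]
  simp [Matrix.mul_apply, Fin.sum_univ_two]
  ring

theorem mem_Gamma0_two_iff (γ : SL(2, ℤ)) : γ ∈ Gamma0 2 ↔ (2 : ℤ) ∣ γ 1 0 := by
  rw [Gamma0_mem]
  exact_mod_cast ZMod.intCast_zmod_eq_zero_iff_dvd (γ 1 0) 2

/-- `Γ₀(2)` is generated by `T`, `S T² S⁻¹` and `-1`. The proof is a Euclidean algorithm on the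
first column of a matrix, of which the top entry is odd and the bottom entry even. -/
theorem Gamma0_two_le {H : Subgroup SL(2, ℤ)} (hT : T ∈ H) (hV : S * T ^ 2 * S⁻¹ ∈ H)
    (hneg : -1 ∈ H) : Gamma0 2 ≤ H := by
  suffices ∀ n : ℕ, ∀ γ : SL(2, ℤ), (γ 1 0).natAbs = n → γ ∈ Gamma0 2 → γ ∈ H from
    fun γ hγ ↦ this _ γ rfl hγ
  intro n
  induction n using Nat.strong_induction_on with
  | _ n ih =>
    intro γ hn hγ
    have h2 := (mem_Gamma0_two_iff γ).mp hγ
    have hdet := Matrix.det_fin_two γ.1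
    rw [γ.2] at hdet
    by_cases hc : γ 1 0 = 0
    · have had : γ 0 0 * γ 1 1 = 1 := by
        have : (γ.1 1 0) = 0 := hc
        rw [this] at hdet; linarith
      rcases Int.mul_eq_one_iff_eq_one_or_neg_one.mp had with ⟨h0, h1⟩ | ⟨h0, h1⟩
      · have : γ = T ^ (γ 0 1) := by
          ext i j
          fin_cases i <;> fin_cases j <;> simp [coe_T_zpow, h0, h1, hc]
        rw [this]; exact zpow_mem hT _
      · have : γ = -1 * T ^ (-γ 0 1) := by
          ext i j
          fin_cases i <;> fin_cases j <;> simp [coe_T_zpow, h0, h1, hc]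
        rw [this]; exact mul_mem hneg (zpow_mem hT _)
    · -- Reduce the top entry modulo the bottom one, then the bottom one modulo twice the top one.
      set a := γ 0 0 with ha
      set c := γ 1 0 with hc'
      set a' := a % c with ha'
      have ha'c : a' = a - c * (a / c) := by rw [ha', Int.emod_def]
      have ha'odd : ¬ (2 : ℤ) ∣ a' := by
        intro h
        have h2a : (2 : ℤ) ∣ a := by
          have := dvd_add h (Dvd.dvd.mul_right h2 (a / c))
          rwa [ha'c, sub_add_cancel] at this
        have : (2 : ℤ) ∣ 1 := by
          rw [hdet]
          exact dvd_sub (Dvd.dvd.mul_right h2a _) (Dvd.dvd.mul_left h2 _)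
        omega
      have ha'0 : 0 < a' := lt_of_le_of_ne (Int.emod_nonneg _ hc) (by
        rintro h; simp [← h] at ha'odd)
      have ha'lt : a' < |c| := Int.emod_lt_abs _ hc
      obtain ⟨m, hm⟩ : ∃ m : ℤ, |c - 2 * m * a'| ≤ a' := by
        refine ⟨(c + a') / (2 * a'), ?_⟩
        have h1 := Int.emod_add_mul_ediv (c + a') (2 * a')
        have h3 := Int.emod_nonneg (c + a') (show 2 * a' ≠ 0 by omega)
        have h4 := Int.emod_lt_of_pos (c + a') (show 0 < 2 * a' by omega)
        rw [abs_le]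
        constructor <;> nlinarith
      let γ' : SL(2, ℤ) := (S * T ^ 2 * S⁻¹) ^ m * (T ^ (-(a / c)) * γ)
      have hγ'10 : γ' 1 0 = c - 2 * m * a' := by
        rw [zpow_mul_T_zpow_mul_apply_one_zero, ha'c]
        ring
      have hmem : γ' ∈ H := by
        refine ih (γ' 1 0).natAbs ?_ γ' rfl ?_
        · rw [hγ'10, ← hn, ← Int.ofNat_lt, Int.natCast_natAbs, Int.natCast_natAbs]; omega
        · rw [mem_Gamma0_two_iff, hγ'10]
          exact dvd_sub h2 ⟨m * a', by ring⟩
      have : γ = T ^ (a / c) * ((S * T ^ 2 * S⁻¹) ^ (-m) * γ') := by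
        simp only [γ', _root_.zpow_neg]; group
      rw [this]
      exact mul_mem (zpow_mem hT _) (mul_mem (zpow_mem hV _) hmem)

/-- The coset decomposition `SL(2, ℤ) = Γ₀(2) ∪ ⋃ⱼ Γ₀(2) S Tʲ`. -/
theorem mem_Gamma0_two_or_exists (γ : SL(2, ℤ)) :
    γ ∈ Gamma0 2 ∨ ∃ γ' ∈ Gamma0 2, ∃ j : ℤ, γ = γ' * S * T ^ j := by
  by_cases h : (2 : ℤ) ∣ γ 1 0
  · exact .inl ((mem_Gamma0_two_iff γ).mpr h)
  · refine .inr ⟨γ * T ^ (-γ 1 1) * S⁻¹, ?_, γ 1 1, by simp⟩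
    rw [mem_Gamma0_two_iff, mul_T_zpow_mul_S_inv_apply_one_zero, dvd_neg,
      show -γ 1 1 * γ 1 0 + γ 1 1 = γ 1 1 * (1 - γ 1 0) by ring]
    exact Dvd.dvd.mul_left (by omega) _

/-! ### Functions that are weakly modular on `Γ₀(2)` -/

/-- `F` is holomorphic on the upper half plane and weakly modular of weight `k` on `Γ₀(2)`, and
`G` is its transform under `S`, which describes the behaviour of `F` at the cusp `0`. Modularity
is recorded through `F|T = F` and `G|T² = G`, which for even `k` amounts to invariance under
`Γ₀(2)`, since this group is generated by `T`, `S T² S⁻¹` and `-1`. -/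
structure WeaklyModular (k : ℤ) (F G : ℍ → ℂ) : Prop where
  holo : MDiff F
  slash_T : F ∣[k] T = F
  slash_S : F ∣[k] S = G
  slash_T_sq : G ∣[k] (T ^ 2 : SL(2, ℤ)) = G

/-- The group `Γ₀(2)` inside `GL(2, ℝ)`. -/
abbrev Gamma02 : Subgroup (GL (Fin 2) ℝ) :=
  (Gamma0 2).map (SpecialLinearGroup.mapGL ℝ)

lemma slash_neg_one {k : ℤ} (hk : Even k) (F : ℍ → ℂ) : F ∣[k] (-1 : SL(2, ℤ)) = F := by
  ext z
  rw [SL_slash_apply]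
  simp [denom, hk.neg_one_zpow]

lemma T_zpow_apply_one_zero (n : ℤ) : ((T ^ n : SL(2, ℤ)) : GL (Fin 2) ℝ) 1 0 = 0 := by
  change (((T ^ n : SL(2, ℤ)) 1 0 : ℤ) : ℝ) = 0
  rw [coe_T_zpow]; simp

lemma slash_T_zpow_apply (F : ℍ → ℂ) (k : ℤ) (n : ℤ) (z : ℍ) :
    (F ∣[k] (T ^ n)) z = F ((n : ℝ) +ᵥ z) := by
  rw [SL_slash_apply, modular_T_zpow_smul, ModularGroup.denom_apply, coe_T_zpow]
  simp

lemma slash_T_apply (F : ℍ → ℂ) (k : ℤ) (z : ℍ) : (F ∣[k] T) z = F ((1 : ℝ) +ᵥ z) := by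
  simpa using slash_T_zpow_apply F k 1 z

namespace WeaklyModular

variable {k l : ℤ} {F G F' G' : ℍ → ℂ}

protected lemma add (h : WeaklyModular k F G) (h' : WeaklyModular k F' G') :
    WeaklyModular k (F + F') (G + G') where
  holo := h.holo.add h'.holo
  slash_T := by rw [SlashAction.add_slash, h.slash_T, h'.slash_T]
  slash_S := by rw [SlashAction.add_slash, h.slash_S, h'.slash_S]
  slash_T_sq := by rw [SlashAction.add_slash, h.slash_T_sq, h'.slash_T_sq]

protected lemma smul (h : WeaklyModular k F G) (c : ℂ) :
    WeaklyModular k (c • F) (c • G) where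
  holo := h.holo.const_smul c
  slash_T := by rw [SL_smul_slash, h.slash_T]
  slash_S := by rw [SL_smul_slash, h.slash_S]
  slash_T_sq := by rw [SL_smul_slash, h.slash_T_sq]

protected lemma mul (h : WeaklyModular k F G) (h' : WeaklyModular l F' G') :
    WeaklyModular (k + l) (F * F') (G * G') where
  holo := h.holo.mul h'.holo
  slash_T := by rw [mul_slash_SL2, h.slash_T, h'.slash_T]
  slash_S := by rw [mul_slash_SL2, h.slash_S, h'.slash_S]
  slash_T_sq := by rw [mul_slash_SL2, h.slash_T_sq, h'.slash_T_sq]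

protected lemma pow (h : WeaklyModular k F G) (n : ℕ) :
    WeaklyModular (n * k) (F ^ n) (G ^ n) := by
  induction n with
  | zero =>
    simp only [pow_zero, Nat.cast_zero, zero_mul]
    exact ⟨mdifferentiable_const, is_invariant_one _, is_invariant_one _, is_invariant_one _⟩
  | succ n ih =>
    have := ih.mul h
    rw [pow_succ, pow_succ]
    convert this using 1
    push_cast; ring

protected lemma div (h : WeaklyModular k F G) (h' : WeaklyModular l F' G')
    (h0 : ∀ z, F' z ≠ 0) : WeaklyModular (k - l) (F / F') (G / G') where
  holo := h.holo.div h'.holo h0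
  slash_T := by rw [div_slash_SL2, h.slash_T, h'.slash_T]
  slash_S := by rw [div_slash_SL2, h.slash_S, h'.slash_S]
  slash_T_sq := by rw [div_slash_SL2, h.slash_T_sq, h'.slash_T_sq]

lemma holo_right (h : WeaklyModular k F G) : MDiff G := by
  rw [← h.slash_S]
  exact h.holo.slash k _

lemma slash_eq (h : WeaklyModular k F G) (hk : Even k) {γ : SL(2, ℤ)} (hγ : γ ∈ Gamma0 2) :
    F ∣[k] γ = F := by
  let H : Subgroup SL(2, ℤ) :=
    { carrier := {γ | F ∣[k] γ = F}
      mul_mem' := fun {a b} ha hb ↦ by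
        simp only [Set.mem_ofPred_eq] at *
        rw [SlashAction.slash_mul, ha, hb]
      one_mem' := SlashAction.slash_one _ _
      inv_mem' := fun {a} ha ↦ by
        simp only [Set.mem_ofPred_eq] at *
        nth_rw 1 [← ha]
        rw [← SlashAction.slash_mul, mul_inv_cancel, SlashAction.slash_one] }
  refine Gamma0_two_le (H := H) h.slash_T ?_ (slash_neg_one hk F) hγ
  change F ∣[k] (S * T ^ 2 * S⁻¹) = F
  rw [SlashAction.slash_mul, SlashAction.slash_mul, h.slash_S, h.slash_T_sq, ← h.slash_S,
    ← SlashAction.slash_mul, mul_inv_cancel, SlashAction.slash_one]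

/-- Every slash transform of `F` is, up to a translation, either `F` or `G`. -/
lemma slash_eq_or (h : WeaklyModular k F G) (hk : Even k) (γ : SL(2, ℤ)) :
    F ∣[k] γ = F ∨ ∃ j : ℤ, F ∣[k] γ = G ∣[k] (T ^ j) := by
  obtain hγ | ⟨γ', hγ', j, rfl⟩ := mem_Gamma0_two_or_exists γ
  · exact .inl (h.slash_eq hk hγ)
  · exact .inr ⟨j, by rw [SlashAction.slash_mul, SlashAction.slash_mul, h.slash_eq hk hγ',
      h.slash_S]⟩

lemma exists_modularForm (h : WeaklyModular k F G) (hk : Even k) (hF : IsBoundedAtImInfty F)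
    (hG : IsBoundedAtImInfty G) : ∃ f : ModularForm Gamma02 k, ⇑f = F := by
  refine ⟨{ toFun := F
            slash_action_eq' := ?_
            holo' := h.holo
            bdd_at_cusps' := fun {c} hc ↦ ?_ }, rfl⟩
  · rintro _ ⟨γ, hγ, rfl⟩
    exact h.slash_eq hk hγ
  · rw [Subgroup.IsArithmetic.isCusp_iff_isCusp_SL2Z] at hc
    rw [OnePoint.isBoundedAt_iff_forall_SL2Z hc]
    intro γ _
    obtain h' | ⟨j, h'⟩ := h.slash_eq_or hk γ
    · rwa [h']
    · rw [h']
      exact hG.slash k (T_zpow_apply_one_zero j)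

lemma exists_cuspForm (h : WeaklyModular k F G) (hk : Even k) (hF : IsZeroAtImInfty F)
    (hG : IsZeroAtImInfty G) : ∃ f : CuspForm Gamma02 k, ⇑f = F := by
  refine ⟨{ toFun := F
            slash_action_eq' := ?_
            holo' := h.holo
            zero_at_cusps' := fun {c} hc ↦ ?_ }, rfl⟩
  · rintro _ ⟨γ, hγ, rfl⟩
    exact h.slash_eq hk hγ
  · rw [Subgroup.IsArithmetic.isCusp_iff_isCusp_SL2Z] at hc
    rw [OnePoint.isZeroAt_iff_forall_SL2Z hc]
    intro γ _
    obtain h' | ⟨j, h'⟩ := h.slash_eq_or hk γ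
    · rwa [h']
    · rw [h']
      exact hG.slash k (T_zpow_apply_one_zero j)

lemma of_slashInvariant (hF : MDiff F) (h : ∀ γ ∈ Gamma0 2, F ∣[k] γ = F) :
    WeaklyModular k F (F ∣[k] S) where
  holo := hF
  slash_T := h T (by rw [mem_Gamma0_two_iff, coe_T]; simp)
  slash_S := rfl
  slash_T_sq := by
    have hV : S * T ^ 2 * S⁻¹ ∈ Gamma0 2 := by
      have := S_mul_T_sq_mul_S_inv_zpow 1
      rw [zpow_one] at this
      rw [mem_Gamma0_two_iff, this]
      simp
    rw [← SlashAction.slash_mul, ← inv_mul_cancel_right (S * T ^ 2) S, SlashAction.slash_mul,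
      h _ hV]

lemma of_modularFormClass {f : Type*} [FunLike f ℍ ℂ] [ModularFormClass f Gamma02 k] (g : f) :
    WeaklyModular k g (⇑g ∣[k] S) :=
  of_slashInvariant (ModularFormClass.holo g) fun γ hγ ↦
    SlashInvariantFormClass.slash_action_eq g _ ⟨γ, hγ, rfl⟩

end WeaklyModular

end Group

open UpperHalfPlane hiding I
open ModularGroup ModularForm Filter Function Complex Derivative
open EisensteinSeries (E2 D2_S)
open PowerSeries (coeff)
open scoped Manifold Topology Real

local notation "𝕢" => Periodic.qParam

/-! ### Functions with a `q`-expansion -/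

/-- `F` is the sum of the power series `p` in `q = e^{2πiτ}` on the whole upper half plane. -/
def HasQExpansion (F : ℍ → ℂ) (p : PowerSeries ℂ) : Prop :=
  ∀ τ : ℍ, HasSum (fun n : ℕ ↦ p.coeff n * 𝕢 1 τ ^ n) (F τ)

namespace HasQExpansion

variable {F G : ℍ → ℂ} {p r : PowerSeries ℂ}

protected lemma one : HasQExpansion 1 1 := fun τ ↦ by
  convert! hasSum_ite_eq 0 (1 : ℂ) using 2 with n
  · rw [PowerSeries.coeff_one]
    split_ifs with h <;> simp [h]

protected lemma add (hF : HasQExpansion F p) (hG : HasQExpansion G r) :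
    HasQExpansion (F + G) (p + r) := fun τ ↦ by
  simpa [add_mul] using (hF τ).add (hG τ)

protected lemma smul (hF : HasQExpansion F p) (c : ℂ) : HasQExpansion (c • F) (c • p) := fun τ ↦ by
  simpa [mul_assoc] using (hF τ).mul_left c

protected lemma sub (hF : HasQExpansion F p) (hG : HasQExpansion G r) :
    HasQExpansion (F - G) (p - r) := fun τ ↦ by
  simpa [sub_mul] using (hF τ).sub (hG τ)

protected lemma mul (hF : HasQExpansion F p) (hG : HasQExpansion G r) :
    HasQExpansion (F * G) (p * r) := fun τ ↦ by
  have h1 := (hF τ).summable.norm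
  have h2 := (hG τ).summable.norm
  have h := (summable_norm_sum_mul_antidiagonal_of_summable_norm h1 h2).of_norm.hasSum
  rw [← tsum_mul_tsum_eq_tsum_sum_antidiagonal_of_summable_norm h1 h2, (hF τ).tsum_eq,
    (hG τ).tsum_eq] at h
  convert! h using 2 with n
  rw [PowerSeries.coeff_mul, Finset.sum_mul]
  refine Finset.sum_congr rfl fun x hx ↦ ?_
  rw [← Finset.HasAntidiagonal.mem_antidiagonal.mp hx, pow_add]
  ring

protected lemma isBoundedAtImInfty (hF : HasQExpansion F p) : IsBoundedAtImInfty F :=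
  isBoundedAtImInfty_of_hasSum_qExpansion (c := fun n ↦ p.coeff n) one_pos hF

lemma qParam_one_vadd (τ : ℍ) : 𝕢 1 (((1 : ℝ) +ᵥ τ : ℍ) : ℂ) = 𝕢 1 τ := by
  rw [UpperHalfPlane.coe_vadd, add_comm]
  rw [Periodic.qParam, Periodic.qParam, mul_add, add_div, Complex.exp_add]
  simp

lemma one_vadd (hF : HasQExpansion F p) (τ : ℍ) : F ((1 : ℝ) +ᵥ τ) = F τ := by
  have := hF ((1 : ℝ) +ᵥ τ)
  rw [qParam_one_vadd] at this
  exact this.unique (hF τ)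

lemma slash_T (hF : HasQExpansion F p) (k : ℤ) : F ∣[k] T = F := by
  ext τ
  rw [slash_T_apply, hF.one_vadd]

end HasQExpansion

/-- A function on the upper half plane with period `h`, extended to `ℂ` through `ofComplex`, is
still periodic. -/
lemma periodic_comp_ofComplex_of_vadd {F : ℍ → ℂ} {h : ℝ} (hF : ∀ τ : ℍ, F (h +ᵥ τ) = F τ) :
    Periodic (F ∘ ofComplex) h := by
  intro w
  by_cases! hw : 0 < im w
  · have : 0 < im (w + h) := by simp [hw]
    simp only [comp_apply, ofComplex_apply_of_im_pos this, ofComplex_apply_of_im_pos hw]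
    rw [← hF ⟨w, hw⟩]
    congr 1
    ext
    simp [add_comm]
  · have : im (w + h) ≤ 0 := by simpa using hw
    simp [ofComplex_apply_of_im_nonpos this, ofComplex_apply_of_im_nonpos hw]

namespace HasQExpansion

variable {F G : ℍ → ℂ} {p r : PowerSeries ℂ}

lemma periodic (hF : HasQExpansion F p) : Periodic (F ∘ ofComplex) (1 : ℝ) :=
  periodic_comp_ofComplex_of_vadd hF.one_vadd

lemma unique (hF : HasQExpansion F p) (hF' : HasQExpansion F r) (hd : MDiff F) : p = r := by
  have han : AnalyticAt ℂ (cuspFunction 1 F) 0 :=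
    analyticAt_cuspFunction_zero one_pos hF.periodic hd hF.isBoundedAtImInfty
  have h1 := hasFPowerSeriesOnBall_cuspFunction (c := fun n ↦ p.coeff n) one_pos han hF
  have h2 := hasFPowerSeriesOnBall_cuspFunction (c := fun n ↦ r.coeff n) one_pos han hF'
  ext n
  simpa using congr_arg (FormalMultilinearSeries.coeff · n)
    (h1.hasFPowerSeriesAt.eq_formalMultilinearSeries h2.hasFPowerSeriesAt)

lemma of_bounded (hd : MDiff F) (hper : ∀ τ, F ((1 : ℝ) +ᵥ τ) = F τ) (hb : IsBoundedAtImInfty F) :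
    HasQExpansion F (qExpansion 1 F) :=
  hasSum_qExpansion one_pos (periodic_comp_ofComplex_of_vadd hper) hd hb

/-- Dividing by `q ^ m` a `q`-expansion whose first `m` coefficients vanish. -/
lemma div_qParam_pow (hF : HasQExpansion F p) (m : ℕ) (hp : ∀ i < m, p.coeff i = 0) :
    HasQExpansion (fun τ ↦ F τ / 𝕢 1 τ ^ m) (PowerSeries.mk fun n ↦ p.coeff (n + m)) := fun τ ↦ by
  have hq : 𝕢 1 (τ : ℂ) ≠ 0 := Periodic.qParam_ne_zero _
  have h := (hasSum_nat_add_iff' m).mpr (hF τ)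
  rw [Finset.sum_eq_zero fun i hi ↦ by rw [hp i (Finset.mem_range.mp hi), zero_mul], sub_zero] at h
  convert! h.div_const (𝕢 1 (τ : ℂ) ^ m) using 2 with n
  rw [PowerSeries.coeff_mk, pow_add]
  field_simp

lemma isBigO_qParam_pow (hF : HasQExpansion F p) (m : ℕ) (hp : ∀ i < m, p.coeff i = 0) :
    F =O[atImInfty] fun τ : ℍ ↦ 𝕢 1 τ ^ m := by
  have hb : (fun τ : ℍ ↦ F τ / 𝕢 1 τ ^ m) =O[atImInfty] (1 : ℍ → ℝ) :=
    (hF.div_qParam_pow m hp).isBoundedAtImInfty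
  have h := hb.mul (Asymptotics.isBigO_refl (fun τ : ℍ ↦ 𝕢 1 (τ : ℂ) ^ m) atImInfty).norm_right
  rw [← Asymptotics.isBigO_norm_right]
  refine h.congr (fun τ ↦ ?_) fun τ ↦ by simp
  exact div_mul_cancel₀ _ (pow_ne_zero _ (Periodic.qParam_ne_zero _))

lemma tendsto_atImInfty (hF : HasQExpansion F p) : Tendsto F atImInfty (𝓝 (p.coeff 0)) := by
  have h1 : HasQExpansion (F - p.coeff 0 • 1) (p - p.coeff 0 • 1) :=
    hF.sub (HasQExpansion.one.smul _)
  have h2 := h1.isBigO_qParam_pow 1 fun i hi ↦ by simp [Nat.lt_one_iff.mp hi]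
  have h3 := h2.trans_tendsto (by simpa using qParam_tendsto_atImInfty one_pos)
  simpa [sub_eq_add_neg] using h3.add_const (p.coeff 0)

end HasQExpansion

/-! ### Rescaling the variable -/

/-- The map `τ ↦ 2τ` on the upper half plane. -/
noncomputable def double (τ : ℍ) : ℍ := ⟨2 * τ, by simpa using τ.im_pos⟩

/-- The map `τ ↦ τ/2` on the upper half plane. -/
noncomputable def halve (τ : ℍ) : ℍ := ⟨τ / 2, by simpa using τ.im_pos⟩

@[simp] lemma coe_double (τ : ℍ) : (double τ : ℂ) = 2 * τ := rfl

@[simp] lemma coe_halve (τ : ℍ) : (halve τ : ℂ) = τ / 2 := rfl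

lemma double_S_smul (τ : ℍ) : double (S • τ) = S • halve τ := by
  ext
  rw [coe_double, modular_S_smul, modular_S_smul]
  simp only [coe_halve]
  field_simp [τ.ne_zero]

lemma halve_T_sq_smul (τ : ℍ) : halve ((2 : ℝ) +ᵥ τ) = (1 : ℝ) +ᵥ halve τ := by
  ext
  simp [add_div]

lemma tendsto_halve : Tendsto halve atImInfty atImInfty := by
  rw [atImInfty, tendsto_comap_iff]
  have : UpperHalfPlane.im ∘ halve = fun τ ↦ τ.im / 2 := by
    ext τ
    change ((τ : ℂ) / 2).im = _
    simp
  rw [this]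
  exact tendsto_comap.atTop_div_const two_pos

lemma mdifferentiable_comp_double {F : ℍ → ℂ} (hF : MDiff F) : MDiff (F ∘ double) := by
  rw [UpperHalfPlane.mdifferentiable_iff] at hF ⊢
  have : DifferentiableOn ℂ (fun w : ℂ ↦ (F ∘ ofComplex) (2 * w)) upperHalfPlaneSet :=
    hF.comp (by fun_prop) fun w hw ↦ by simpa using hw
  refine this.congr fun w hw ↦ ?_
  have h2 : 0 < (2 * w).im := by simpa using hw
  simp only [comp_apply, ofComplex_apply_of_im_pos hw, ofComplex_apply_of_im_pos h2]
  rfl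

lemma mdifferentiable_comp_halve {F : ℍ → ℂ} (hF : MDiff F) : MDiff (F ∘ halve) := by
  rw [UpperHalfPlane.mdifferentiable_iff] at hF ⊢
  have : DifferentiableOn ℂ (fun w : ℂ ↦ (F ∘ ofComplex) (w / 2)) upperHalfPlaneSet :=
    hF.comp (by fun_prop) fun w hw ↦ by simpa using hw
  refine this.congr fun w hw ↦ ?_
  have h2 : 0 < (w / 2).im := by simpa using hw
  simp only [comp_apply, ofComplex_apply_of_im_pos hw, ofComplex_apply_of_im_pos h2]
  rfl

/-- The power series `p(X²)`. -/
noncomputable def substSq (p : PowerSeries ℂ) : PowerSeries ℂ :=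
  PowerSeries.mk fun n ↦ if 2 ∣ n then p.coeff (n / 2) else 0

protected lemma HasQExpansion.double {F : ℍ → ℂ} {p : PowerSeries ℂ} (hF : HasQExpansion F p) :
    HasQExpansion (F ∘ double) (substSq p) := fun τ ↦ by
  have hinj : Function.Injective fun n : ℕ ↦ 2 * n := fun a b h ↦ by simpa using h
  have h := hF (double τ)
  rw [comp_apply, ← hinj.hasSum_iff]
  · convert h using 2 with n
    have : 𝕢 1 (double τ : ℂ) = 𝕢 1 (τ : ℂ) ^ 2 := by
      rw [Periodic.qParam, Periodic.qParam, ← Complex.exp_nat_mul, coe_double]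
      congr 1
      push_cast; ring
    rw [this]
    simp [substSq, pow_mul]
  · intro n hn
    have : ¬ 2 ∣ n := fun ⟨m, hm⟩ ↦ hn ⟨m, hm.symm⟩
    simp [substSq, this]

/-! ### The derivative `D = (2πi)⁻¹ d/dτ` and the Serre derivative -/

/-- The operator `X d/dX` on power series. -/
noncomputable def theta (p : PowerSeries ℂ) : PowerSeries ℂ :=
  PowerSeries.mk fun n ↦ n * p.coeff n

lemma hasDerivAt_qParam_pow (n : ℕ) (w : ℂ) :
    HasDerivAt (fun w ↦ 𝕢 1 w ^ n) (2 * π * I * n * 𝕢 1 w ^ n) w := by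
  have h : (fun w : ℂ ↦ 𝕢 1 w ^ n) = fun w ↦ Complex.exp (2 * π * I * n * w) := by
    ext w
    rw [Periodic.qParam, ← Complex.exp_nat_mul]
    congr 1
    push_cast; ring
  have h2 := ((hasDerivAt_id w).const_mul (2 * π * I * n)).cexp
  rw [h]
  convert! h2 using 1
  rw [congrFun h w]
  simp [mul_comm]

/-- A `q`-expansion may be differentiated term by term: on the half plane `Im w > Im τ / 2` the
series is dominated by its values at the point `i Im τ / 2`. -/
lemma HasQExpansion.D {F : ℍ → ℂ} {p : PowerSeries ℂ} (hF : HasQExpansion F p) :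
    HasQExpansion (normalizedDerivOfComplex F) (theta p) := fun τ ↦ by
  have hy : 0 < τ.im / 2 := half_pos τ.im_pos
  let τ₀ : ℍ := ⟨(τ.im / 2 : ℝ) * I, by simpa using hy⟩
  let U : Set ℂ := {w | τ.im / 2 < w.im}
  have hU : IsOpen U := isOpen_lt continuous_const Complex.continuous_im
  have hτ : (τ : ℂ) ∈ U := half_lt_self τ.im_pos
  have hnorm (w : ℂ) : ‖𝕢 1 w‖ = Real.exp (-2 * π * w.im) := by
    simp [Periodic.norm_qParam]
  have hle (n : ℕ) (w : ℂ) (hw : w ∈ U) :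
      ‖p.coeff n * 𝕢 1 w ^ n‖ ≤ ‖p.coeff n * 𝕢 1 (τ₀ : ℂ) ^ n‖ := by
    rw [norm_mul, norm_mul, norm_pow, norm_pow, hnorm, hnorm]
    have : (τ₀ : ℂ).im ≤ w.im := by
      have : (τ₀ : ℂ).im = τ.im / 2 := by simp [τ₀]
      rw [this]; exact le_of_lt hw
    have := Real.exp_le_exp.mpr (mul_le_mul_of_nonpos_left this
      (show -2 * π ≤ 0 by linarith [Real.pi_pos]))
    gcongr
  have h := hasSum_deriv_of_summable_norm (hF τ₀).summable.norm
    (fun n w _ ↦ ((hasDerivAt_qParam_pow n w).const_mul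
      (p.coeff n)).differentiableAt.differentiableWithinAt) hU hle hτ
  have hev : (fun w ↦ ∑' n : ℕ, p.coeff n * 𝕢 1 w ^ n) =ᶠ[𝓝 (τ : ℂ)] F ∘ ofComplex := by
    filter_upwards [isOpen_upperHalfPlaneSet.mem_nhds τ.im_pos] with w hw
    rw [comp_apply, ofComplex_apply_of_im_pos hw]
    exact (hF ⟨w, hw⟩).tsum_eq
  rw [hev.deriv_eq] at h
  have hpi : (2 * π * I : ℂ) ≠ 0 := two_pi_I_ne_zero
  convert! h.mul_left (2 * π * I)⁻¹ using 2 with n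
  rw [((hasDerivAt_qParam_pow n (τ : ℂ)).const_mul (p.coeff n)).deriv, theta,
    PowerSeries.coeff_mk]
  field_simp

lemma D_comp_halve {F : ℍ → ℂ} (hF : MDiff F) :
    normalizedDerivOfComplex (F ∘ halve) = (1 / 2 : ℂ) • (normalizedDerivOfComplex F ∘ halve) := by
  ext τ
  have hev : (F ∘ halve) ∘ ofComplex =ᶠ[𝓝 (τ : ℂ)] fun w ↦ (F ∘ ofComplex) (w / 2) := by
    filter_upwards [isOpen_upperHalfPlaneSet.mem_nhds τ.im_pos] with w hw
    have h2 : 0 < (w / 2).im := by simpa using hw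
    simp only [comp_apply, ofComplex_apply_of_im_pos hw, ofComplex_apply_of_im_pos h2]
    rfl
  have h1 : HasDerivAt (F ∘ ofComplex) (deriv (F ∘ ofComplex) (halve τ)) ((τ : ℂ) / 2) :=
    (UpperHalfPlane.mdifferentiableAt_iff.mp (hF (halve τ))).hasDerivAt
  have h2 := h1.comp (τ : ℂ) ((hasDerivAt_id (τ : ℂ)).div_const 2)
  simp only [normalizedDerivOfComplex, hev.deriv_eq, Pi.smul_apply, comp_apply, smul_eq_mul]
  rw [show deriv (fun w ↦ F (ofComplex (w / 2))) τ = _ from h2.deriv]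
  ring

lemma WeaklyModular.serreDerivative {k : ℤ} {F G : ℍ → ℂ} (h : WeaklyModular k F G) :
    WeaklyModular (k + 2) (serreDerivative k F) (serreDerivative k G) where
  holo := serreDerivative_mdifferentiable k h.holo
  slash_T := by rw [serreDerivative_slash_equivariant h.holo, h.slash_T]
  slash_S := by rw [serreDerivative_slash_equivariant h.holo, h.slash_S]
  slash_T_sq := by rw [serreDerivative_slash_equivariant h.holo_right, h.slash_T_sq]

/-- The transform at the cusp `0` of `F(2τ)`, for `F` of level one, is a multiple of `F(τ/2)`. -/
lemma WeaklyModular.comp_double {k : ℤ} {F : ℍ → ℂ} (hd : MDiff F) (hT : F ∣[k] T = F)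
    (hS : F ∣[k] S = F) :
    WeaklyModular k (F ∘ double) (((2 : ℂ) ^ (-k)) • (F ∘ halve)) where
  holo := mdifferentiable_comp_double hd
  slash_T := by
    ext τ
    have h1 (τ) : F ((1 : ℝ) +ᵥ τ) = F τ := by rw [← slash_T_apply F k, hT]
    have h2 : double ((1 : ℝ) +ᵥ τ) = (1 : ℝ) +ᵥ ((1 : ℝ) +ᵥ double τ) := by
      ext
      simp; ring
    rw [slash_T_apply, comp_apply, h2, h1, h1, comp_apply]
  slash_S := by
    ext τ
    have h1 := congrFun hS (halve τ)
    rw [SlashInvariantForm.slash_S_apply, ← modular_S_smul] at h1 ⊢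
    rw [comp_apply, double_S_smul, Pi.smul_apply, comp_apply, ← h1, coe_halve, div_zpow,
      smul_eq_mul]
    have : (2 : ℂ) ^ (-k) ≠ 0 := zpow_ne_zero _ two_ne_zero
    field_simp
  slash_T_sq := by
    ext τ
    have h1 (τ) : F ((1 : ℝ) +ᵥ τ) = F τ := by rw [← slash_T_apply F k, hT]
    have h2 := slash_T_zpow_apply (((2 : ℂ) ^ (-k)) • (F ∘ halve)) k 2 τ
    rw [show (T ^ (2 : ℤ)) = T ^ 2 from zpow_natCast T 2] at h2
    rw [h2, Pi.smul_apply, Pi.smul_apply, comp_apply, comp_apply, Int.cast_ofNat, halve_T_sq_smul,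
      h1]

/-! ### The eta quotients `(η(τ)η(2τ))⁸` and `η(2τ)¹⁶/η(τ)⁸` -/

/-- The eighth power of the Dedekind eta function. -/
noncomputable def etaEight (τ : ℍ) : ℂ := ModularForm.eta τ ^ 8

/-- The factor `∏ (1 - qⁿ)⁸` of `η⁸`. -/
noncomputable def eulerEight (τ : ℍ) : ℂ := (∏' n : ℕ, (1 - 𝕢 1 τ ^ (n + 1))) ^ 8

lemma etaEight_eq (τ : ℍ) : etaEight τ = 𝕢 3 τ * eulerEight τ := by
  rw [etaEight, ModularForm.eta, mul_pow, eulerEight]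
  congr 1
  rw [Periodic.qParam, Periodic.qParam, ← Complex.exp_nat_mul]
  congr 1
  push_cast; ring

lemma etaEight_ne_zero (τ : ℍ) : etaEight τ ≠ 0 := pow_ne_zero _ (eta_ne_zero τ.im_pos)

lemma mdifferentiable_etaEight : MDiff etaEight := by
  rw [UpperHalfPlane.mdifferentiable_iff]
  have : DifferentiableOn ℂ (fun w ↦ ModularForm.eta w ^ 8) upperHalfPlaneSet := fun w hw ↦
    ((differentiableAt_eta_of_mem_upperHalfPlaneSet hw).pow 8).differentiableWithinAt
  refine this.congr fun w hw ↦ ?_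
  simp [etaEight, ofComplex_apply_of_im_pos hw]

lemma etaEight_one_vadd (τ : ℍ) :
    etaEight ((1 : ℝ) +ᵥ τ) = exp (2 * π * I / 3) * etaEight τ := by
  rw [etaEight_eq, etaEight_eq, eulerEight, HasQExpansion.qParam_one_vadd, ← eulerEight,
    ← mul_assoc]
  congr 1
  rw [Periodic.qParam, Periodic.qParam, ← Complex.exp_add, UpperHalfPlane.coe_vadd]
  congr 1
  push_cast; ring

lemma etaEight_S_smul (τ : ℍ) : etaEight (S • τ) = (τ : ℂ) ^ 4 * etaEight τ := by
  have h := eta_comp_eq_csqrt_I_inv τ.im_pos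
  simp only [comp_apply, Pi.smul_apply, Pi.mul_apply, smul_eq_mul] at h
  -- The eighth power removes the choice of a branch of the square root.
  have hsq (z : ℂ) (hz : z ≠ 0) : sqrt z ^ 8 = z ^ 4 := by
    rw [sqrt_eq_exp hz, ← Complex.exp_nat_mul]
    rw [show ((8 : ℕ) : ℂ) * (log z / 2) = (4 : ℕ) * log z by push_cast; ring,
      Complex.exp_nat_mul, exp_log hz]
  rw [etaEight, modular_S_smul]
  have : (((⟨(-(τ : ℂ))⁻¹, τ.im_inv_neg_coe_pos⟩ : ℍ)) : ℂ) = -1 / τ := by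
    change (-(τ : ℂ))⁻¹ = _
    rw [inv_neg, neg_div, one_div]
  rw [this, h, mul_pow, mul_pow, inv_pow, hsq _ I_ne_zero, hsq _ τ.ne_zero, I_pow_four, etaEight]
  simp

lemma etaEight_two_vadd (τ : ℍ) :
    etaEight ((2 : ℝ) +ᵥ τ) = exp (2 * π * I / 3) ^ 2 * etaEight τ := by
  have : (2 : ℝ) +ᵥ τ = (1 : ℝ) +ᵥ ((1 : ℝ) +ᵥ τ) := by rw [← add_vadd]; norm_num
  rw [this, etaEight_one_vadd, etaEight_one_vadd]
  ring

lemma double_one_vadd (τ : ℍ) : double ((1 : ℝ) +ᵥ τ) = (2 : ℝ) +ᵥ double τ := by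
  ext
  simp; ring

lemma exp_two_pi_I_div_three_pow : exp (2 * π * I / 3) ^ 3 = 1 := by
  rw [← Complex.exp_nat_mul, ← Complex.exp_two_pi_mul_I]
  congr 1
  push_cast; ring

/-- The transform `2⁻⁴ (η(τ)η(τ/2))⁸` of `Δ₈,₂` at the cusp `0`. -/
noncomputable def deltaZero (τ : ℍ) : ℂ := (2 ^ 4 : ℂ)⁻¹ * (etaEight τ * etaEight (halve τ))

/-- The eta quotient `η(2τ)¹⁶/η(τ)⁸`, of weight `4`. Its only zero is a simple one at `∞`. -/
noncomputable def hauptFactor (τ : ℍ) : ℂ := etaEight (double τ) ^ 2 / etaEight τ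

/-- The transform `2⁻⁸ η(τ/2)¹⁶/η(τ)⁸` of `η(2τ)¹⁶/η(τ)⁸` at the cusp `0`. -/
noncomputable def hauptFactorZero (τ : ℍ) : ℂ :=
  (2 ^ 8 : ℂ)⁻¹ * (etaEight (halve τ) ^ 2 / etaEight τ)

lemma Delta82_eq (τ : ℍ) : Delta82 τ = etaEight τ * etaEight (double τ) := by
  rw [Delta82, mul_pow]; rfl

lemma Delta82_ne_zero (τ : ℍ) : Delta82 τ ≠ 0 := by
  rw [Delta82_eq]
  exact mul_ne_zero (etaEight_ne_zero _) (etaEight_ne_zero _)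

lemma hauptFactor_ne_zero (τ : ℍ) : hauptFactor τ ≠ 0 :=
  div_ne_zero (pow_ne_zero _ (etaEight_ne_zero _)) (etaEight_ne_zero _)

/-- A pointwise criterion for weak modularity. -/
lemma WeaklyModular.of_apply {k : ℤ} {F G : ℍ → ℂ} (hd : MDiff F)
    (hT : ∀ τ, F ((1 : ℝ) +ᵥ τ) = F τ) (hS : ∀ τ : ℍ, F (S • τ) = (τ : ℂ) ^ k * G τ)
    (hT2 : ∀ τ, G ((2 : ℝ) +ᵥ τ) = G τ) : WeaklyModular k F G where
  holo := hd
  slash_T := by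
    ext τ
    rw [slash_T_apply, hT]
  slash_S := by
    ext τ
    rw [SlashInvariantForm.slash_S_apply, ← modular_S_smul, hS, zpow_neg, mul_comm, ← mul_assoc,
      inv_mul_cancel₀ (zpow_ne_zero _ τ.ne_zero), one_mul]
  slash_T_sq := by
    ext τ
    rw [← zpow_natCast, slash_T_zpow_apply]
    exact_mod_cast hT2 τ

lemma weaklyModular_Delta82 : WeaklyModular 8 Delta82 deltaZero := by
  have heq : Delta82 = etaEight * (etaEight ∘ double) := funext Delta82_eq
  refine .of_apply ?_ (fun τ ↦ ?_) (fun τ ↦ ?_) fun τ ↦ ?_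
  · rw [heq]
    exact mdifferentiable_etaEight.mul (mdifferentiable_comp_double mdifferentiable_etaEight)
  · rw [Delta82_eq, Delta82_eq, double_one_vadd, etaEight_one_vadd, etaEight_two_vadd]
    linear_combination (etaEight τ * etaEight (double τ)) * exp_two_pi_I_div_three_pow
  · rw [Delta82_eq, double_S_smul, etaEight_S_smul, etaEight_S_smul, coe_halve, deltaZero]
    rw [show (τ : ℂ) ^ (8 : ℤ) = (τ : ℂ) ^ 8 from zpow_natCast _ 8]
    ring
  · rw [deltaZero, deltaZero, halve_T_sq_smul, etaEight_one_vadd, etaEight_two_vadd]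
    linear_combination (2 ^ 4 : ℂ)⁻¹ * (etaEight τ * etaEight (halve τ)) *
      exp_two_pi_I_div_three_pow

lemma weaklyModular_hauptFactor : WeaklyModular 4 hauptFactor hauptFactorZero := by
  have h0 : exp (2 * π * I / 3) ≠ 0 := exp_ne_zero _
  have heq : hauptFactor = (etaEight ∘ double) * (etaEight ∘ double) / etaEight :=
    funext fun τ ↦ by simp [hauptFactor, sq]
  refine .of_apply ?_ (fun τ ↦ ?_) (fun τ ↦ ?_) fun τ ↦ ?_
  · rw [heq]
    have h := mdifferentiable_comp_double mdifferentiable_etaEight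
    exact (h.mul h).div mdifferentiable_etaEight etaEight_ne_zero
  · rw [hauptFactor, hauptFactor, double_one_vadd, etaEight_one_vadd, etaEight_two_vadd]
    have := etaEight_ne_zero τ
    field_simp
    linear_combination (etaEight (double τ) ^ 2) * exp_two_pi_I_div_three_pow
  · rw [hauptFactor, double_S_smul, etaEight_S_smul, etaEight_S_smul, coe_halve, hauptFactorZero]
    rw [show (τ : ℂ) ^ (4 : ℤ) = (τ : ℂ) ^ 4 from zpow_natCast _ 4]
    have := etaEight_ne_zero τ
    have := τ.ne_zero
    field_simp
  · rw [hauptFactorZero, hauptFactorZero, halve_T_sq_smul, etaEight_one_vadd, etaEight_two_vadd]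
    have := etaEight_ne_zero τ
    field_simp

lemma tendsto_double : Tendsto double atImInfty atImInfty := by
  rw [atImInfty, tendsto_comap_iff]
  have : UpperHalfPlane.im ∘ double = fun τ ↦ 2 * τ.im := by
    ext τ
    change (2 * (τ : ℂ)).im = _
    simp
  rw [this]
  exact tendsto_comap.const_mul_atTop two_pos

lemma tendsto_eulerEight : Tendsto eulerEight atImInfty (𝓝 1) := by
  have h0 : (0 : ℂ) ∈ Metric.ball (0 : ℂ) 1 := Metric.mem_ball_self one_pos
  have h : Tendsto (fun q : ℂ ↦ ∏' n : ℕ, (1 - q ^ (n + 1))) (𝓝 0) (𝓝 1) := by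
    have := (differentiableOn_tprod_one_sub_pow.differentiableAt
      (Metric.isOpen_ball.mem_nhds h0)).continuousAt.tendsto
    simpa using this
  have h8 := (h.comp (qParam_tendsto_atImInfty one_pos)).pow 8
  rw [one_pow] at h8
  exact h8

lemma tendsto_Delta82_div : Tendsto (fun τ ↦ Delta82 τ / 𝕢 1 τ) atImInfty (𝓝 1) := by
  have h := tendsto_eulerEight.mul (tendsto_eulerEight.comp tendsto_double)
  rw [mul_one] at h
  refine h.congr fun τ ↦ ?_
  have hq : 𝕢 3 (τ : ℂ) * 𝕢 3 (double τ) = 𝕢 1 τ := by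
    rw [Periodic.qParam, Periodic.qParam, Periodic.qParam, ← Complex.exp_add, coe_double]
    congr 1
    push_cast; ring
  rw [Delta82_eq, etaEight_eq, etaEight_eq, ← hq]
  have h1 : 𝕢 3 (τ : ℂ) ≠ 0 := Periodic.qParam_ne_zero _
  have h2 : 𝕢 3 (double τ : ℂ) ≠ 0 := Periodic.qParam_ne_zero _
  simp only [comp_apply]
  field_simp

lemma tendsto_hauptFactor_div : Tendsto (fun τ ↦ hauptFactor τ / 𝕢 1 τ) atImInfty (𝓝 1) := by
  have h := ((tendsto_eulerEight.comp tendsto_double).pow 2).div tendsto_eulerEight one_ne_zero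
  rw [one_pow, div_one] at h
  refine h.congr fun τ ↦ ?_
  have hq : 𝕢 1 (τ : ℂ) * 𝕢 3 τ = 𝕢 3 (double τ) ^ 2 := by
    rw [Periodic.qParam, Periodic.qParam, Periodic.qParam, ← Complex.exp_add, ← Complex.exp_nat_mul,
      coe_double]
    congr 1
    push_cast; ring
  have h1 : 𝕢 3 (τ : ℂ) ≠ 0 := Periodic.qParam_ne_zero _
  have h2 : 𝕢 1 (τ : ℂ) ≠ 0 := Periodic.qParam_ne_zero _
  rw [hauptFactor, etaEight_eq, etaEight_eq, mul_pow, ← hq]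
  simp only [comp_apply, Pi.div_apply]
  rw [mul_div_mul_comm, mul_div_assoc, mul_div_assoc]
  field_simp

lemma tendsto_deltaZero_div :
    Tendsto (fun τ ↦ deltaZero τ / 𝕢 2 τ) atImInfty (𝓝 (2 ^ 4 : ℂ)⁻¹) := by
  have h := (tendsto_eulerEight.mul (tendsto_eulerEight.comp tendsto_halve)).const_mul
    (2 ^ 4 : ℂ)⁻¹
  rw [mul_one, mul_one] at h
  refine h.congr fun τ ↦ ?_
  have hq : 𝕢 3 (τ : ℂ) * 𝕢 3 (halve τ) = 𝕢 2 τ := by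
    rw [Periodic.qParam, Periodic.qParam, Periodic.qParam, ← Complex.exp_add, coe_halve]
    congr 1
    push_cast; ring
  rw [deltaZero, etaEight_eq, etaEight_eq, ← hq]
  have h1 : 𝕢 3 (τ : ℂ) ≠ 0 := Periodic.qParam_ne_zero _
  have h2 : 𝕢 3 (halve τ : ℂ) ≠ 0 := Periodic.qParam_ne_zero _
  simp only [comp_apply]
  field_simp

lemma tendsto_hauptFactorZero : Tendsto hauptFactorZero atImInfty (𝓝 (2 ^ 8 : ℂ)⁻¹) := by
  have h := (((tendsto_eulerEight.comp tendsto_halve).pow 2).div tendsto_eulerEight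
    one_ne_zero).const_mul (2 ^ 8 : ℂ)⁻¹
  rw [one_pow, div_one, mul_one] at h
  refine h.congr fun τ ↦ ?_
  have hq : 𝕢 3 (τ : ℂ) = 𝕢 3 (halve τ) ^ 2 := by
    rw [Periodic.qParam, Periodic.qParam, ← Complex.exp_nat_mul, coe_halve]
    congr 1
    push_cast; ring
  have h1 : 𝕢 3 (τ : ℂ) ≠ 0 := Periodic.qParam_ne_zero _
  rw [hauptFactorZero, etaEight_eq, etaEight_eq, mul_pow, ← hq, mul_div_mul_left _ _ h1]
  rfl

lemma isBigO_of_tendsto_div {F E : ℍ → ℂ} {c : ℂ} (hc : c ≠ 0) (hF : ∀ τ, F τ ≠ 0)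
    (h : Tendsto (fun τ ↦ F τ / E τ) atImInfty (𝓝 c)) : E =O[atImInfty] F := by
  refine Asymptotics.isBigO_of_div_tendsto_nhds (.of_forall fun τ h0 ↦ absurd h0 (hF τ)) c⁻¹ ?_
  exact (h.inv₀ hc).congr fun τ ↦ by simp

/-! ### Vanishing and the space `S₈(Γ₀(2))` -/

lemma isBoundedAtImInfty_div {F E : ℍ → ℂ} (h : F =O[atImInfty] E) :
    IsBoundedAtImInfty (F / E) :=
  (Asymptotics.div_isBoundedUnder_of_isBigO h).isBigO_one ℝ

lemma hauptFactorZero_ne_zero (τ : ℍ) : hauptFactorZero τ ≠ 0 :=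
  mul_ne_zero (by norm_num)
    (div_ne_zero (pow_ne_zero _ (etaEight_ne_zero _)) (etaEight_ne_zero _))

lemma deltaZero_ne_zero (τ : ℍ) : deltaZero τ ≠ 0 :=
  mul_ne_zero (by norm_num) (mul_ne_zero (etaEight_ne_zero _) (etaEight_ne_zero _))

/-- A form of weight `k` on `Γ₀(2)` that vanishes at `∞` to an order `m > k/4` is zero: its
quotient by the `m`-th power of `η(2τ)¹⁶/η(τ)⁸` is a modular form of negative weight. -/
theorem WeaklyModular.eq_zero {k : ℤ} {F G : ℍ → ℂ} (h : WeaklyModular k F G) (hk : Even k) (m : ℕ)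
    (hF : F =O[atImInfty] fun τ : ℍ ↦ 𝕢 1 τ ^ m) (hG : IsBoundedAtImInfty G) (hkm : k < m * 4) :
    F = 0 := by
  have hpow := weaklyModular_hauptFactor.pow m
  have hne (τ : ℍ) : (hauptFactor ^ m) τ ≠ 0 := pow_ne_zero _ (hauptFactor_ne_zero τ)
  have hdiv := h.div hpow hne
  have hinf : (fun τ : ℍ ↦ 𝕢 1 (τ : ℂ) ^ m) =O[atImInfty] (hauptFactor ^ m) :=
    (isBigO_of_tendsto_div one_ne_zero hauptFactor_ne_zero tendsto_hauptFactor_div).pow m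
  have hzero : (fun _ : ℍ ↦ (1 : ℂ)) =O[atImInfty] (hauptFactorZero ^ m) := by
    have h1 := isBigO_of_tendsto_div (E := fun _ ↦ 1) (c := (2 ^ 8 : ℂ)⁻¹) (by norm_num)
      hauptFactorZero_ne_zero (by simpa using tendsto_hauptFactorZero)
    simpa using! h1.pow m
  have hG1 : G =O[atImInfty] fun _ : ℍ ↦ (1 : ℂ) :=
    hG.trans (Asymptotics.isBigO_of_le _ fun _ ↦ by simp)
  obtain ⟨f, hf⟩ := hdiv.exists_modularForm (hk.sub ((by decide : Even (4 : ℤ)).mul_left _))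
    (isBoundedAtImInfty_div (hF.trans hinf)) (isBoundedAtImInfty_div (hG1.trans hzero))
  have hf0 : f = 0 := ModularForm.isZero_of_neg_weight (by linarith) f
  ext τ
  have := congrFun hf τ
  rw [hf0] at this
  simpa [hne τ, hauptFactor_ne_zero τ] using this.symm

lemma isZeroAtImInfty_of_tendsto_div {F : ℍ → ℂ} {c : ℂ} {h : ℝ} (hh : 0 < h)
    (hF : Tendsto (fun τ ↦ F τ / 𝕢 h τ) atImInfty (𝓝 c)) : IsZeroAtImInfty F := by
  have h1 := hF.mul (qParam_tendsto_atImInfty hh)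
  rw [mul_zero] at h1
  exact h1.congr fun τ ↦ div_mul_cancel₀ _ (Periodic.qParam_ne_zero _)

lemma exists_cuspForm_Delta82 : ∃ f : CuspForms82, ⇑f = Delta82 :=
  weaklyModular_Delta82.exists_cuspForm (by decide)
    (isZeroAtImInfty_of_tendsto_div one_pos tendsto_Delta82_div)
    (isZeroAtImInfty_of_tendsto_div two_pos tendsto_deltaZero_div)

lemma isBigO_qParam_of_isZeroAtImInfty {F : ℍ → ℂ} {h : ℝ} (hh : 0 < h) (hd : MDiff F)
    (hper : ∀ τ, F (h +ᵥ τ) = F τ) (h0 : IsZeroAtImInfty F) :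
    F =O[atImInfty] fun τ : ℍ ↦ 𝕢 h τ := by
  have := h0.exp_decay_atImInfty hh (periodic_comp_ofComplex_of_vadd hper) hd h0.isBoundedAtImInfty
  refine this.trans (Asymptotics.isBigO_of_le _ fun τ ↦ ?_)
  rw [Periodic.norm_qParam, Real.norm_of_nonneg (Real.exp_pos _).le]
  rfl

/-- The quotient of a cusp form of weight `8` by `Δ₈,₂` is a modular form of weight `0`, hence
constant: `Δ₈,₂` has no zero on the upper half plane and vanishes at both cusps to the least
possible order. -/
theorem exists_eq_smul_Delta82 (g : CuspForms82) : ∃ c : ℂ, ⇑g = c • Delta82 := by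
  have hg : WeaklyModular 8 g (⇑g ∣[(8 : ℤ)] S) := .of_modularFormClass g
  have hz (γ : SL(2, ℤ)) : IsZeroAtImInfty (⇑g ∣[(8 : ℤ)] γ) := by
    have hc : IsCusp (Matrix.SpecialLinearGroup.mapGL ℝ γ • OnePoint.infty) 𝒮ℒ :=
      isCusp_SL2Z_iff'.mpr ⟨γ, rfl⟩
    exact (OnePoint.isZeroAt_iff_forall_SL2Z hc).mp (CuspFormClass.zero_at_cusps g
      ((Subgroup.IsArithmetic.isCusp_iff_isCusp_SL2Z _).mpr hc)) γ rfl
  have h1 : ⇑g =O[atImInfty] Delta82 := by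
    refine (isBigO_qParam_of_isZeroAtImInfty one_pos hg.holo (fun τ ↦ ?_) ?_).trans
      (isBigO_of_tendsto_div one_ne_zero Delta82_ne_zero tendsto_Delta82_div)
    · rw [← slash_T_apply (⇑g) 8, hg.slash_T]
    · simpa using hz 1
  have h2 : (⇑g ∣[(8 : ℤ)] S) =O[atImInfty] deltaZero := by
    refine (isBigO_qParam_of_isZeroAtImInfty two_pos hg.holo_right (fun τ ↦ ?_) (hz S)).trans
      (isBigO_of_tendsto_div (by norm_num) deltaZero_ne_zero tendsto_deltaZero_div)
    have := congrFun hg.slash_T_sq τ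
    rw [← zpow_natCast, slash_T_zpow_apply] at this
    exact_mod_cast this
  obtain ⟨f, hf⟩ := (hg.div weaklyModular_Delta82 Delta82_ne_zero).exists_modularForm (by decide)
    (isBoundedAtImInfty_div h1) (isBoundedAtImInfty_div h2)
  obtain ⟨c, hc⟩ := ModularForm.eq_const_of_weight_zero (𝒢 := Gamma02) f
  refine ⟨c, funext fun τ ↦ ?_⟩
  have := congrFun (hf.symm.trans hc) τ
  rw [Pi.div_apply, Function.const_apply, div_eq_iff (Delta82_ne_zero τ)] at this
  exact this

lemma hasQExpansion_Delta82 : HasQExpansion Delta82 (qExpansion 1 Delta82) := by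
  refine .of_bounded weaklyModular_Delta82.holo (fun τ ↦ ?_)
    (isZeroAtImInfty_of_tendsto_div one_pos tendsto_Delta82_div).isBoundedAtImInfty
  rw [← slash_T_apply Delta82 8, weaklyModular_Delta82.slash_T]

lemma tau82_zero : tau82 0 = 0 :=
  tendsto_nhds_unique hasQExpansion_Delta82.tendsto_atImInfty
    (isZeroAtImInfty_of_tendsto_div one_pos tendsto_Delta82_div)

lemma tau82_one : tau82 1 = 1 := by
  -- `τ(1)` is the constant term of `Δ₈,₂ / q`.
  have h := (hasQExpansion_Delta82.div_qParam_pow 1 fun i hi ↦ by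
    rw [Nat.lt_one_iff.mp hi]; exact tau82_zero).tendsto_atImInfty
  simp only [pow_one, PowerSeries.coeff_mk, zero_add] at h
  exact tendsto_nhds_unique h tendsto_Delta82_div

/-! ### Modular forms with their `q`-expansions -/

/-- `F` is a modular form of weight `k` on `SL(2, ℤ)`, with expansion `p` in powers of
`q = e^{2πiτ}`. Invariance under `T` and boundedness at `∞` are part of the expansion. -/
structure IsLevelOneForm (k : ℤ) (F : ℍ → ℂ) (p : PowerSeries ℂ) : Prop where
  holo : MDiff F
  slash_S : F ∣[k] S = F
  hasQExpansion : HasQExpansion F p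

/-- `F` is a modular form of weight `k` on `Γ₀(2)`, with expansion `p` in powers of
`q = e^{2πiτ}`. The transform of `F` at the cusp `0` is only asked to be bounded. -/
structure IsLevelTwoForm (k : ℤ) (F : ℍ → ℂ) (p : PowerSeries ℂ) : Prop where
  exists_zero : ∃ G, WeaklyModular k F G ∧ IsBoundedAtImInfty G
  hasQExpansion : HasQExpansion F p

/-- The power series `∑ σⱼ(n) Xⁿ`. -/
noncomputable def sigmaSeries (j : ℕ) : PowerSeries ℂ := PowerSeries.mk fun n ↦ (σ j n : ℂ)

/-- The `q`-expansion of `E₂`. -/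
noncomputable def seriesE₂ : PowerSeries ℂ := 1 + (-24 : ℂ) • sigmaSeries 1

/-- The `q`-expansion of `E₄`. -/
noncomputable def seriesE₄ : PowerSeries ℂ := 1 + (240 : ℂ) • sigmaSeries 3

/-- The `q`-expansion of `E₆`. -/
noncomputable def seriesE₆ : PowerSeries ℂ := 1 + (-504 : ℂ) • sigmaSeries 5

/-- The `q`-expansion of `E₈`. -/
noncomputable def seriesE₈ : PowerSeries ℂ := 1 + (480 : ℂ) • sigmaSeries 7

lemma HasQExpansion.isBoundedAtImInfty_comp_halve {F : ℍ → ℂ} {p : PowerSeries ℂ}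
    (h : HasQExpansion F p) : IsBoundedAtImInfty (F ∘ halve) :=
  h.isBoundedAtImInfty.comp_tendsto tendsto_halve

lemma hasQExpansion_E2 : HasQExpansion E2 seriesE₂ := fun τ ↦ by
  convert! EisensteinSeries.hasSum_qExpansion_E2 (z := τ) using 2 with n
  rcases eq_or_ne n 0 with rfl | hn
  · simp [seriesE₂, sigmaSeries]
  · simp [hn, seriesE₂, sigmaSeries, PowerSeries.coeff_one, Periodic.qParam]

lemma serreDerivative_eq_sub (k : ℂ) (F : ℍ → ℂ) :
    serreDerivative k F = normalizedDerivOfComplex F - (k / 12) • (E2 * F) := by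
  ext z
  simp only [serreDerivative_apply, Pi.sub_apply, Pi.smul_apply, Pi.mul_apply, smul_eq_mul]
  ring

/-- The operator `X d/dX - (k/12) E₂` on power series, which gives the `q`-expansion of the Serre
derivative. -/
noncomputable def serreSeries (k : ℤ) (p : PowerSeries ℂ) : PowerSeries ℂ :=
  theta p - ((k : ℂ) / 12) • (seriesE₂ * p)

lemma HasQExpansion.serreDerivative {F : ℍ → ℂ} {p : PowerSeries ℂ} (h : HasQExpansion F p)
    (k : ℤ) : HasQExpansion (serreDerivative k F) (serreSeries k p) := by
  rw [serreDerivative_eq_sub]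
  exact h.D.sub ((hasQExpansion_E2.mul h).smul _)

namespace IsLevelOneForm

variable {k : ℤ} {F : ℍ → ℂ} {p : PowerSeries ℂ}

lemma weaklyModular (h : IsLevelOneForm k F p) : WeaklyModular k F F where
  holo := h.holo
  slash_T := h.hasQExpansion.slash_T k
  slash_S := h.slash_S
  slash_T_sq := by rw [pow_two, SlashAction.slash_mul, h.hasQExpansion.slash_T k,
    h.hasQExpansion.slash_T k]

lemma isLevelTwoForm (h : IsLevelOneForm k F p) : IsLevelTwoForm k F p :=
  ⟨⟨F, h.weaklyModular, h.hasQExpansion.isBoundedAtImInfty⟩, h.hasQExpansion⟩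

lemma double (h : IsLevelOneForm k F p) : IsLevelTwoForm k (F ∘ double) (substSq p) :=
  ⟨⟨_, .comp_double h.holo (h.hasQExpansion.slash_T k) h.slash_S,
    h.hasQExpansion.isBoundedAtImInfty_comp_halve.const_smul_left _⟩, h.hasQExpansion.double⟩

lemma serreDerivative (h : IsLevelOneForm k F p) :
    IsLevelTwoForm (k + 2) (serreDerivative k F) (serreSeries k p) :=
  ⟨⟨_, h.weaklyModular.serreDerivative, (h.hasQExpansion.serreDerivative k).isBoundedAtImInfty⟩,
    h.hasQExpansion.serreDerivative k⟩

/-- The Serre derivative of `F(2τ)`. Its transform at the cusp `0` is bounded because it is a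
multiple of the Serre derivative of `F(τ/2)`. -/
lemma serreDerivative_double (h : IsLevelOneForm k F p) :
    IsLevelTwoForm (k + 2) (Derivative.serreDerivative k (F ∘ LevelTwo.double))
      (serreSeries k (substSq p)) := by
  have hd := WeaklyModular.comp_double h.holo (h.hasQExpansion.slash_T k) h.slash_S
  refine ⟨⟨_, hd.serreDerivative, ?_⟩, h.hasQExpansion.double.serreDerivative k⟩
  rw [serreDerivative_smul _ _ _ (mdifferentiable_comp_halve h.holo), serreDerivative_eq_sub,
    D_comp_halve h.holo]
  have h1 := h.hasQExpansion.D.isBoundedAtImInfty_comp_halve.const_smul_left (1 / 2 : ℂ)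
  have h2 := (hasQExpansion_E2.isBoundedAtImInfty.mul
    h.hasQExpansion.isBoundedAtImInfty_comp_halve).const_smul_left ((k : ℂ) / 12)
  exact (h1.sub h2).const_smul_left _

end IsLevelOneForm

namespace IsLevelTwoForm

variable {k l : ℤ} {F G : ℍ → ℂ} {p r : PowerSeries ℂ}

lemma add (hF : IsLevelTwoForm k F p) (hG : IsLevelTwoForm k G r) :
    IsLevelTwoForm k (F + G) (p + r) := by
  obtain ⟨⟨F', hF1, hF2⟩, hF3⟩ := hF
  obtain ⟨⟨G', hG1, hG2⟩, hG3⟩ := hG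
  exact ⟨⟨_, hF1.add hG1, hF2.add hG2⟩, hF3.add hG3⟩

lemma smul (hF : IsLevelTwoForm k F p) (c : ℂ) : IsLevelTwoForm k (c • F) (c • p) := by
  obtain ⟨⟨F', hF1, hF2⟩, hF3⟩ := hF
  exact ⟨⟨_, hF1.smul c, hF2.const_smul_left c⟩, hF3.smul c⟩

lemma mul (hF : IsLevelTwoForm k F p) (hG : IsLevelTwoForm l G r) :
    IsLevelTwoForm (k + l) (F * G) (p * r) := by
  obtain ⟨⟨F', hF1, hF2⟩, hF3⟩ := hF
  obtain ⟨⟨G', hG1, hG2⟩, hG3⟩ := hG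
  exact ⟨⟨_, hF1.mul hG1, hF2.mul hG2⟩, hF3.mul hG3⟩

/-- A modular form of weight `k` on `Γ₀(2)` is determined by its Fourier coefficients of index at
most `k/4`. -/
theorem series_eq_zero (hF : IsLevelTwoForm k F p) (hk : Even k) (m : ℕ) (hkm : k < m * 4)
    (hp : ∀ i < m, p.coeff i = 0) : p = 0 := by
  obtain ⟨⟨G, hG, hb⟩, hF⟩ := hF
  have h0 := hG.eq_zero hk m (hF.isBigO_qParam_pow m hp) hb hkm
  subst h0
  have := HasQExpansion.one.smul (0 : ℂ)
  rw [zero_smul, zero_smul] at this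
  exact hF.unique this hG.holo

end IsLevelTwoForm

/-! ### The Eisenstein series of weights `2`, `4`, `6` and `8` -/

lemma isLevelOneForm_E {k : ℕ} (hk : 3 ≤ k) (hk2 : Even k) {c : ℂ}
    (hc : -(2 * k / bernoulli k : ℂ) = c) :
    IsLevelOneForm k (E hk) (1 + c • sigmaSeries (k - 1)) where
  holo := ModularFormClass.holo (E hk)
  slash_S := SlashInvariantFormClass.slash_action_eq (E hk) _ ⟨S, rfl⟩
  hasQExpansion := by
    have h : HasQExpansion (E hk) (qExpansion 1 (E hk)) := by
      refine .of_bounded (ModularFormClass.holo (E hk)) (fun τ ↦ ?_)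
        (ModularFormClass.bdd_at_infty (E hk))
      rw [← slash_T_apply (E hk) k]
      exact congrFun (SlashInvariantFormClass.slash_action_eq (E hk) _ ⟨T, rfl⟩) τ
    convert! h using 1
    ext n
    rw [EisensteinSeries.E_qExpansion_coeff hk hk2, hc]
    rcases eq_or_ne n 0 with rfl | hn
    · simp [sigmaSeries]
    · simp [hn, PowerSeries.coeff_one, sigmaSeries]

lemma isLevelOneForm_E₄ : IsLevelOneForm 4 E₄ seriesE₄ :=
  isLevelOneForm_E (by norm_num) (by decide) (by
    rw [show bernoulli 4 = -1 / 30 by decide +kernel]; norm_num)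

lemma isLevelOneForm_E₆ : IsLevelOneForm 6 E₆ seriesE₆ :=
  isLevelOneForm_E (by norm_num) (by decide) (by
    rw [show bernoulli 6 = 1 / 42 by decide +kernel]; norm_num)

lemma isLevelOneForm_E₈ :
    IsLevelOneForm 8 (E (by norm_num : 3 ≤ 8)) seriesE₈ :=
  isLevelOneForm_E (by norm_num) (by decide) (by
    rw [show bernoulli 8 = -1 / 30 by decide +kernel]; norm_num)

/-- The form `2 E₂(2τ) - E₂(τ)` of weight `2` on `Γ₀(2)`, in which the failure of `E₂` to be
modular cancels. -/
noncomputable def phiTwo : ℍ → ℂ := (2 : ℂ) • (E2 ∘ double) + (-1 : ℂ) • E2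

lemma E2_S_smul (τ : ℍ) : E2 (S • τ) = (τ : ℂ) ^ 2 * (E2 τ - 6 * I / (π * τ)) := by
  have h := congrFun (EisensteinSeries.E2_slash_action S) τ
  rw [SlashInvariantForm.slash_S_apply, ← modular_S_smul, Pi.sub_apply, Pi.smul_apply, D2_S,
    riemannZeta_two] at h
  have h0 := τ.ne_zero
  have hpi : (π : ℂ) ≠ 0 := by exact_mod_cast Real.pi_ne_zero
  have h2 : E2 (S • τ) = (τ : ℂ) ^ 2 * (E2 (S • τ) * (τ : ℂ) ^ (-2 : ℤ)) := by
    rw [_root_.zpow_neg]; norm_cast; field_simp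
  rw [h2, h, smul_eq_mul]
  congr 2
  field_simp

lemma isLevelTwoForm_phiTwo : IsLevelTwoForm 2 phiTwo
    ((2 : ℂ) • substSq seriesE₂ + (-1 : ℂ) • seriesE₂) := by
  have hexp := (hasQExpansion_E2.double.smul (2 : ℂ)).add (hasQExpansion_E2.smul (-1 : ℂ))
  have hd : MDiff phiTwo := ((mdifferentiable_comp_double E2_mdifferentiable).const_smul _).add
    (E2_mdifferentiable.const_smul _)
  refine ⟨⟨(1 / 2 : ℂ) • (E2 ∘ halve) + (-1 : ℂ) • E2, .of_apply hd hexp.one_vadd ?_ ?_, ?_⟩, hexp⟩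
  · intro τ
    have h0 := τ.ne_zero
    have hpi : (π : ℂ) ≠ 0 := by exact_mod_cast Real.pi_ne_zero
    simp only [phiTwo, Pi.add_apply, Pi.smul_apply, comp_apply, smul_eq_mul, double_S_smul,
      E2_S_smul, coe_halve]
    rw [show (τ : ℂ) ^ (2 : ℤ) = (τ : ℂ) ^ 2 from zpow_natCast _ 2]
    field_simp
    ring
  · intro τ
    have h2 : E2 ((2 : ℝ) +ᵥ τ) = E2 τ := by
      rw [show (2 : ℝ) +ᵥ τ = (1 : ℝ) +ᵥ ((1 : ℝ) +ᵥ τ) by rw [← add_vadd]; norm_num,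
        hasQExpansion_E2.one_vadd, hasQExpansion_E2.one_vadd]
    simp only [Pi.add_apply, Pi.smul_apply, comp_apply, halve_T_sq_smul,
      hasQExpansion_E2.one_vadd, h2]
  · exact (hasQExpansion_E2.isBoundedAtImInfty_comp_halve.const_smul_left _).add
      (hasQExpansion_E2.isBoundedAtImInfty.const_smul_left _)

/-! ### The logarithmic derivative of `Δ₈,₂` -/

lemma isLevelTwoForm_Delta82 : IsLevelTwoForm 8 Delta82 (PowerSeries.mk tau82) := by
  refine ⟨⟨_, weaklyModular_Delta82,
    (isZeroAtImInfty_of_tendsto_div two_pos tendsto_deltaZero_div).isBoundedAtImInfty⟩, ?_⟩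
  convert! hasQExpansion_Delta82 using 1
  ext n
  simp [tau82]

/-- The logarithmic derivative of `Δ₈,₂`, obtained from that of `η`, which is a multiple of
`E₂`. -/
lemma D_Delta82 : normalizedDerivOfComplex Delta82 =
    (1 / 3 : ℂ) • ((E2 + (2 : ℂ) • (E2 ∘ double)) * Delta82) := by
  ext τ
  have hd (τ : ℍ) : HasDerivAt ModularForm.eta (π * I / 12 * E2 τ * ModularForm.eta τ) τ := by
    have h := logDeriv_eta_eq_E2 τ
    rw [logDeriv_apply, div_eq_iff (eta_ne_zero τ.im_pos)] at h
    rw [← h]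
    exact (differentiableAt_eta_of_mem_upperHalfPlaneSet τ.im_pos).hasDerivAt
  have h2 : HasDerivAt (fun w ↦ ModularForm.eta (2 * w))
      (π * I / 12 * E2 (double τ) * ModularForm.eta (2 * τ) * 2) (τ : ℂ) := by
    have := (hasDerivAt_id (τ : ℂ)).const_mul 2
    rw [mul_one] at this
    exact HasDerivAt.comp (h₂ := ModularForm.eta) (τ : ℂ) (hd (double τ)) this
  have h3 := ((hd τ).mul h2).pow 8
  have hev : Delta82 ∘ ofComplex =ᶠ[𝓝 (τ : ℂ)]
      (ModularForm.eta * fun w ↦ ModularForm.eta (2 * w)) ^ 8 := by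
    filter_upwards [isOpen_upperHalfPlaneSet.mem_nhds τ.im_pos] with w hw
    rw [comp_apply, ofComplex_apply_of_im_pos hw]
    rfl
  have hpi : (π : ℂ) ≠ 0 := by exact_mod_cast Real.pi_ne_zero
  rw [normalizedDerivOfComplex, hev.deriv_eq, h3.deriv]
  simp only [Pi.smul_apply, Pi.mul_apply, Pi.add_apply, comp_apply, smul_eq_mul, Delta82]
  field_simp [I_ne_zero]
  push_cast
  ring

lemma tau82_two : tau82 2 = -8 := by
  -- Compare the coefficients of `q²` in the two expansions of `D Δ₈,₂`.
  have h1 := isLevelTwoForm_Delta82.hasQExpansion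
  have h2 := ((hasQExpansion_E2.add (hasQExpansion_E2.double.smul 2)).mul h1).smul (1 / 3)
  rw [← D_Delta82] at h2
  have h3 := congr_arg (PowerSeries.coeff 2)
    (h1.D.unique h2 (normalizedDerivOfComplex_mdifferentiable weaklyModular_Delta82.holo))
  simp [theta, substSq, seriesE₂, sigmaSeries, PowerSeries.coeff_mul,
    Finset.Nat.antidiagonal_succ, tau82_zero, tau82_one, PowerSeries.coeff_one] at h3
  linear_combination h3

/-! ### Identities between `q`-expansions -/

lemma sigma_two (j : ℕ) : σ j 2 = 1 + 2 ^ j := by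
  rw [ArithmeticFunction.sigma_apply, Nat.prime_two.divisors, Finset.sum_pair (by norm_num),
    one_pow]

lemma substSq_one_add_smul (c : ℂ) (p : PowerSeries ℂ) :
    substSq (1 + c • p) = 1 + c • substSq p := by
  ext n
  simp only [substSq, PowerSeries.coeff_mk, map_add, map_smul, smul_eq_mul, PowerSeries.coeff_one]
  split_ifs <;> first | omega | simp

/-- The identity `ϑE₄ = -E₆/3` for the Serre derivative `ϑ`. -/
lemma serreSeries_E₄ : serreSeries 4 seriesE₄ + (1 / 3 : ℂ) • seriesE₆ = 0 := by
  refine (isLevelOneForm_E₄.serreDerivative.add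
    (isLevelOneForm_E₆.isLevelTwoForm.smul (1 / 3))).series_eq_zero (by decide) 2 (by norm_num)
    fun i hi ↦ ?_
  interval_cases i <;>
    norm_num [serreSeries, seriesE₂, seriesE₄, seriesE₆, sigmaSeries, theta,
      PowerSeries.coeff_mul, Finset.Nat.antidiagonal_succ, PowerSeries.coeff_one]

/-- The expression of `ϑ(E₄(2τ))` in terms of `E₆(τ)` and `E₆(2τ)`. -/
lemma serreSeries_substSq_E₄ : serreSeries 4 (substSq seriesE₄) +
    ((1 / 63 : ℂ) • seriesE₆ + (20 / 63 : ℂ) • substSq seriesE₆) = 0 := by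
  refine (isLevelOneForm_E₄.serreDerivative_double.add
    ((isLevelOneForm_E₆.isLevelTwoForm.smul (1 / 63)).add
    (isLevelOneForm_E₆.double.smul (20 / 63)))).series_eq_zero (by decide) 2 (by norm_num)
    fun i hi ↦ ?_
  interval_cases i <;>
    norm_num [serreSeries, seriesE₂, seriesE₄, seriesE₆, sigmaSeries, theta, substSq,
      PowerSeries.coeff_mul, Finset.Nat.antidiagonal_succ, PowerSeries.coeff_one]

/-- The expression of `ϑE₄ - (2 E₂(2τ) - E₂(τ)) E₄ / 3` in terms of `E₆(τ)` and `E₆(2τ)`. This form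
equals `DE₄ - (2/3) E₂(2τ) E₄(τ)`. -/
lemma serreSeries_E₄_sub : serreSeries 4 seriesE₄ +
    ((-1 / 3 : ℂ) • (((2 : ℂ) • substSq seriesE₂ + (-1 : ℂ) • seriesE₂) * seriesE₄) +
    ((10 / 63 : ℂ) • seriesE₆ + (32 / 63 : ℂ) • substSq seriesE₆)) = 0 := by
  refine (isLevelOneForm_E₄.serreDerivative.add
    (((isLevelTwoForm_phiTwo.mul isLevelOneForm_E₄.isLevelTwoForm).smul (-1 / 3)).add
    ((isLevelOneForm_E₆.isLevelTwoForm.smul (10 / 63)).add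
    (isLevelOneForm_E₆.double.smul (32 / 63))))).series_eq_zero (by decide) 2 (by norm_num)
    fun i hi ↦ ?_
  interval_cases i <;>
    norm_num [serreSeries, seriesE₂, seriesE₄, seriesE₆, sigmaSeries, theta, substSq,
      PowerSeries.coeff_mul, Finset.Nat.antidiagonal_succ, PowerSeries.coeff_one]

/-- The identity `ϑE₆ = -E₈/2`. -/
lemma serreSeries_E₆ : serreSeries 6 seriesE₆ + (1 / 2 : ℂ) • seriesE₈ = 0 := by
  refine (isLevelOneForm_E₆.serreDerivative.add
    (isLevelOneForm_E₈.isLevelTwoForm.smul (1 / 2))).series_eq_zero (by decide) 3 (by norm_num)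
    fun i hi ↦ ?_
  interval_cases i <;>
    norm_num [serreSeries, seriesE₂, seriesE₆, seriesE₈, sigmaSeries, theta,
      PowerSeries.coeff_mul, Finset.Nat.antidiagonal_succ, PowerSeries.coeff_one, sigma_two]

/-- The expression of `ϑE₆ - (2 E₂(2τ) - E₂(τ)) E₆ / 2` in terms of `E₈(τ)`, `E₈(2τ)` and `Δ₈,₂`.
This form equals `DE₆ - E₂(2τ) E₆(τ)`. -/
lemma serreSeries_E₆_sub : serreSeries 6 seriesE₆ +
    ((-1 / 2 : ℂ) • (((2 : ℂ) • substSq seriesE₂ + (-1 : ℂ) • seriesE₂) * seriesE₆) +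
    (((21 / 85 : ℂ) • seriesE₈ + (64 / 85 : ℂ) • substSq seriesE₈) +
    (-2016 / 17 : ℂ) • PowerSeries.mk tau82)) = 0 := by
  refine (isLevelOneForm_E₆.serreDerivative.add
    (((isLevelTwoForm_phiTwo.mul isLevelOneForm_E₆.isLevelTwoForm).smul (-1 / 2)).add
    (((isLevelOneForm_E₈.isLevelTwoForm.smul (21 / 85)).add
    (isLevelOneForm_E₈.double.smul (64 / 85))).add
    (isLevelTwoForm_Delta82.smul (-2016 / 17))))).series_eq_zero (by decide) 3 (by norm_num)
    fun i hi ↦ ?_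
  interval_cases i <;>
    norm_num [serreSeries, seriesE₂, seriesE₆, seriesE₈, sigmaSeries, theta, substSq,
      PowerSeries.coeff_mul, Finset.Nat.antidiagonal_succ, PowerSeries.coeff_one, sigma_two,
      tau82_zero, tau82_one, tau82_two]

/-- The expression of `ϑ(E₆(2τ))` in terms of `E₈(τ)`, `E₈(2τ)` and `Δ₈,₂`. -/
lemma serreSeries_substSq_E₆ : serreSeries 6 (substSq seriesE₆) +
    (((1 / 170 : ℂ) • seriesE₈ + (42 / 85 : ℂ) • substSq seriesE₈) +
    (-252 / 17 : ℂ) • PowerSeries.mk tau82) = 0 := by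
  refine (isLevelOneForm_E₆.serreDerivative_double.add
    (((isLevelOneForm_E₈.isLevelTwoForm.smul (1 / 170)).add
    (isLevelOneForm_E₈.double.smul (42 / 85))).add
    (isLevelTwoForm_Delta82.smul (-252 / 17)))).series_eq_zero (by decide) 3 (by norm_num)
    fun i hi ↦ ?_
  interval_cases i <;>
    norm_num [serreSeries, seriesE₂, seriesE₆, seriesE₈, sigmaSeries, theta, substSq,
      PowerSeries.coeff_mul, Finset.Nat.antidiagonal_succ, PowerSeries.coeff_one, sigma_two,
      tau82_zero, tau82_one, tau82_two]

/-! ### Comparison of coefficients -/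

lemma coeff_one_add_smul_mul {n : ℕ} (hn : n ≠ 0) (a b : ℂ) (s t : PowerSeries ℂ) :
    coeff n ((1 + a • s) * (1 + b • t)) =
      a * coeff n s + b * coeff n t + a * b * coeff n (s * t) := by
  rw [show (1 + a • s) * (1 + b • t) = 1 + a • s + b • t + (a * b) • (s * t) by
    rw [mul_add, add_mul, add_mul, smul_mul_smul_comm, mul_one, mul_one, one_mul]; abel]
  simp [PowerSeries.coeff_one, hn]

lemma coeff_sigmaSeries_mul (i j n : ℕ) : coeff n (sigmaSeries i * sigmaSeries j) =
    ∑ k ∈ Finset.range (n + 1), (σ i k : ℂ) * (σ j (n - k) : ℂ) := by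
  rw [PowerSeries.coeff_mul, Finset.Nat.sum_antidiagonal_eq_sum_range_succ_mk]
  simp [sigmaSeries]

lemma coeff_substSq_sigmaSeries (j n : ℕ) :
    coeff n (substSq (sigmaSeries j)) = (sigmaHalf j n : ℂ) := by
  simp only [substSq, sigmaSeries, sigmaHalf, PowerSeries.coeff_mk]
  split_ifs <;> simp

lemma coeff_substSq_sigmaSeries_mul (i j n : ℕ) :
    coeff n (substSq (sigmaSeries i) * sigmaSeries j) =
      ∑ k ∈ Finset.range n with 2 * k < n, (σ i k : ℂ) * (σ j (n - 2 * k) : ℂ) := by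
  rw [PowerSeries.coeff_mul, Finset.Nat.sum_antidiagonal_eq_sum_range_succ_mk]
  symm
  refine Finset.sum_of_injOn (2 * ·) (fun a _ b _ h ↦ by simpa using h) (fun k hk ↦ ?_)
    (fun m hm hm' ↦ ?_) fun k _ ↦ ?_
  · simp only [Finset.coe_filter, Finset.mem_range, Set.mem_ofPred_eq] at hk
    simp only [Finset.coe_range, Set.mem_Iio]
    omega
  · rw [Finset.mem_range] at hm
    by_cases h2 : 2 ∣ m
    · obtain ⟨k, rfl⟩ := h2
      -- The only even index in the range that is not `2 * k` for some `2 * k < n` is `n` itself.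
      have : n - 2 * k = 0 := by
        by_contra h
        exact hm' ⟨k, by simp; omega, rfl⟩
      simp [sigmaSeries, this]
    · simp [substSq, h2]
  · simp [substSq, sigmaSeries]

lemma coeff_serreSeries {n : ℕ} (hn : n ≠ 0) (k : ℤ) (a : ℂ) (s : PowerSeries ℂ) :
    coeff n (serreSeries k (1 + a • s)) = n * (a * coeff n s) - k / 12 *
      (-24 * coeff n (sigmaSeries 1) + a * coeff n s + -24 * a * coeff n (sigmaSeries 1 * s)) := by
  rw [serreSeries, seriesE₂, map_sub, map_smul, coeff_one_add_smul_mul hn]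
  simp [theta, PowerSeries.coeff_one, hn]

lemma coeff_sigmaSeries_mul_substSq (i j n : ℕ) :
    coeff n (sigmaSeries i * substSq (sigmaSeries j)) =
      ∑ k ∈ Finset.range n with 2 * k < n, (σ i (n - 2 * k) : ℂ) * (σ j k : ℂ) := by
  rw [mul_comm, coeff_substSq_sigmaSeries_mul]
  exact Finset.sum_congr rfl fun k _ ↦ mul_comm _ _

lemma coeff_sigmaSeries (j n : ℕ) : coeff n (sigmaSeries j) = (σ j n : ℂ) := by
  simp [sigmaSeries]

lemma coeff_one_add_smul {n : ℕ} (hn : n ≠ 0) (a : ℂ) (s : PowerSeries ℂ) :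
    coeff n (1 + a • s) = a * coeff n s := by
  simp [PowerSeries.coeff_one, hn]

end LevelTwo

theorem mainTheorem6 :
    -- `Δ_{8,2}` is a cusp form of weight 8 on `Γ₀(2)` and spans the space of all such forms;
    -- it is normalised by `Δ_{8,2}(z) = e^{2πiz} + O(e^{4πiz})`.
    (∃ f : CuspForms82, (∀ z : UpperHalfPlane, f z = Delta82 z) ∧
      ∀ g : CuspForms82, ∃ c : ℂ, g = c • f) ∧
    tau82 1 = 1 ∧
    -- the six convolution identities
    ∀ n : ℕ, 0 < n →
      (∑ k ∈ Finset.range (n + 1), (σ 1 k : ℂ) * (σ 3 (n - k) : ℂ)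
        = 7 / 80 * (σ 5 n : ℂ) - 1 / 8 * (n : ℂ) * (σ 3 n : ℂ)
          + 1 / 24 * (σ 3 n : ℂ) - 1 / 240 * (σ 1 n : ℂ)) ∧
      (∑ k ∈ Finset.range n with 2 * k < n, (σ 1 (n - 2 * k) : ℂ) * (σ 3 k : ℂ)
        = 1 / 240 * (σ 5 n : ℂ) + 1 / 12 * (sigmaHalf 5 n : ℂ)
          - 1 / 8 * (n : ℂ) * (sigmaHalf 3 n : ℂ)
          + 1 / 24 * (sigmaHalf 3 n : ℂ) - 1 / 240 * (σ 1 n : ℂ)) ∧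
      (∑ k ∈ Finset.range n with 2 * k < n, (σ 1 k : ℂ) * (σ 3 (n - 2 * k) : ℂ)
        = 1 / 48 * (σ 5 n : ℂ) + 1 / 15 * (sigmaHalf 5 n : ℂ)
          - 1 / 16 * (n : ℂ) * (σ 3 n : ℂ)
          + 1 / 24 * (σ 3 n : ℂ) - 1 / 240 * (sigmaHalf 1 n : ℂ)) ∧
      (∑ k ∈ Finset.range (n + 1), (σ 1 k : ℂ) * (σ 5 (n - k) : ℂ)
        = 5 / 126 * (σ 7 n : ℂ) - 1 / 12 * (n : ℂ) * (σ 5 n : ℂ)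
          + 1 / 24 * (σ 5 n : ℂ) + 1 / 504 * (σ 1 n : ℂ)) ∧
      (∑ k ∈ Finset.range n with 2 * k < n, (σ 1 k : ℂ) * (σ 5 (n - 2 * k) : ℂ)
        = 1 / 102 * (σ 7 n : ℂ) + 32 / 1071 * (sigmaHalf 7 n : ℂ)
          - 1 / 24 * (n : ℂ) * (σ 5 n : ℂ)
          + 1 / 24 * (σ 5 n : ℂ) + 1 / 504 * (sigmaHalf 1 n : ℂ)
          - 1 / 102 * tau82 n) ∧
      (∑ k ∈ Finset.range n with 2 * k < n, (σ 1 (n - 2 * k) : ℂ) * (σ 5 k : ℂ)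
        = 1 / 2142 * (σ 7 n : ℂ) + 2 / 51 * (sigmaHalf 7 n : ℂ)
          - 1 / 12 * (n : ℂ) * (sigmaHalf 5 n : ℂ)
          + 1 / 24 * (sigmaHalf 5 n : ℂ) + 1 / 504 * (σ 1 n : ℂ)
          - 1 / 408 * tau82 n) := by
  refine ⟨?_, LevelTwo.tau82_one, fun n hn ↦ ⟨?_, ?_, ?_, ?_, ?_, ?_⟩⟩
  · obtain ⟨f, hf⟩ := LevelTwo.exists_cuspForm_Delta82
    refine ⟨f, congrFun hf, fun g ↦ ?_⟩
    obtain ⟨c, hc⟩ := LevelTwo.exists_eq_smul_Delta82 g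
    exact ⟨c, DFunLike.ext' (by rw [hc, FunLike.coe_smul, hf])⟩
  -- In each case below, the factor of `h` is the inverse of the coefficient with which the
  -- convolution sum enters the identity `h` between `n`-th Fourier coefficients.
  · have h := congr_arg (PowerSeries.coeff n) LevelTwo.serreSeries_E₄
    simp only [LevelTwo.seriesE₄, LevelTwo.seriesE₆, map_add, map_smul, map_zero, smul_eq_mul,
      LevelTwo.coeff_serreSeries hn.ne', LevelTwo.coeff_one_add_smul hn.ne',
      LevelTwo.coeff_sigmaSeries_mul, LevelTwo.coeff_sigmaSeries] at h
    linear_combination (1 / 1920) * h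
  · have h := congr_arg (PowerSeries.coeff n) LevelTwo.serreSeries_substSq_E₄
    simp only [LevelTwo.seriesE₄, LevelTwo.seriesE₆, LevelTwo.substSq_one_add_smul, map_add,
      map_smul, map_zero, smul_eq_mul, LevelTwo.coeff_serreSeries hn.ne',
      LevelTwo.coeff_one_add_smul hn.ne', LevelTwo.coeff_substSq_sigmaSeries,
      LevelTwo.coeff_sigmaSeries_mul_substSq, LevelTwo.coeff_sigmaSeries] at h
    linear_combination (1 / 1920) * h
  · have h := congr_arg (PowerSeries.coeff n) LevelTwo.serreSeries_E₄_sub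
    rw [add_mul, smul_mul_assoc, smul_mul_assoc] at h
    simp only [LevelTwo.seriesE₂, LevelTwo.seriesE₄, LevelTwo.seriesE₆,
      LevelTwo.substSq_one_add_smul, map_add, map_smul, map_zero, smul_eq_mul,
      LevelTwo.coeff_serreSeries hn.ne', LevelTwo.coeff_one_add_smul_mul hn.ne',
      LevelTwo.coeff_one_add_smul hn.ne', LevelTwo.coeff_substSq_sigmaSeries,
      LevelTwo.coeff_substSq_sigmaSeries_mul, LevelTwo.coeff_sigmaSeries_mul,
      LevelTwo.coeff_sigmaSeries] at h
    linear_combination (1 / 3840) * h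
  · have h := congr_arg (PowerSeries.coeff n) LevelTwo.serreSeries_E₆
    simp only [LevelTwo.seriesE₆, LevelTwo.seriesE₈, map_add, map_smul, map_zero, smul_eq_mul,
      LevelTwo.coeff_serreSeries hn.ne', LevelTwo.coeff_one_add_smul hn.ne',
      LevelTwo.coeff_sigmaSeries_mul, LevelTwo.coeff_sigmaSeries] at h
    linear_combination (-1 / 6048) * h
  · have h := congr_arg (PowerSeries.coeff n) LevelTwo.serreSeries_E₆_sub
    rw [add_mul, smul_mul_assoc, smul_mul_assoc] at h
    simp only [LevelTwo.seriesE₂, LevelTwo.seriesE₆, LevelTwo.seriesE₈,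
      LevelTwo.substSq_one_add_smul, map_add, map_smul, map_zero, smul_eq_mul,
      LevelTwo.coeff_serreSeries hn.ne', LevelTwo.coeff_one_add_smul_mul hn.ne',
      LevelTwo.coeff_one_add_smul hn.ne', LevelTwo.coeff_substSq_sigmaSeries,
      LevelTwo.coeff_substSq_sigmaSeries_mul, LevelTwo.coeff_sigmaSeries_mul,
      LevelTwo.coeff_sigmaSeries, PowerSeries.coeff_mk] at h
    linear_combination (-1 / 12096) * h
  · have h := congr_arg (PowerSeries.coeff n) LevelTwo.serreSeries_substSq_E₆
    simp only [LevelTwo.seriesE₆, LevelTwo.seriesE₈, LevelTwo.substSq_one_add_smul, map_add,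
      map_smul, map_zero, smul_eq_mul, LevelTwo.coeff_serreSeries hn.ne',
      LevelTwo.coeff_one_add_smul hn.ne', LevelTwo.coeff_substSq_sigmaSeries,
      LevelTwo.coeff_sigmaSeries_mul_substSq, LevelTwo.coeff_sigmaSeries, PowerSeries.coeff_mk] at h
    linear_combination (-1 / 6048) * h
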